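/- **Setting.** There are $N$ agents with decisions $x_i\in\mathbb R^{\bar n}$; write $\boldsymbol x=(x_i)_i$, $\operatorname{avg}(\boldsymbol x)=\frac1N\sum_i x_i$. Agent $i$ has the expected cost $$\mathbb J_i(\boldsymbol x)=\mathbb E\big[f_i(x_i,\operatorname{avg}(\boldsymbol x),\xi_i)\big]+g_i(x_i),$$ where $\xi=(\xi_1,\dots,\xi_N)$ has law $\mathbb P$ on $\Xi_1\times\dots\times\Xi_N$, and $g_i$ is convex and lower semicontinuous with nonempty, compact, convex domain $\Omega_i$; put $\boldsymbol\Omega=\prod_i\Omega_i$. The coupling constraints are $\sum_iA_ix_i\le b:=\sum_i b_i$ in $\mathbb R^m$, $\boldsymbol{\mathcal X}=\{\boldsymbol x\in\boldsymbol\Omega:\sum_iA_ix_i\le b\}$, and Slater's condition holds: some $\boldsymbol x\in\boldsymbol\Omega$ satisfies $\sum_iA_ix_i<b$ componentwise. A profile $\boldsymbol x^*\in\boldsymbol{\mathcal X}$ is a stochastic generalized Nash equilibrium (SGNE) if, for every $i$, $x_i^*$ minimizes $\mathbb J_i(\cdot,\boldsymbol x^*_{-i})$ over all $y\in\Omega_i$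 with $A_iy\le b-\sum_{j\ne i}A_jx_j^*$. With the pseudogradient $\mathbb F(\boldsymbol x)=\big(\mathbb E[\nabla_{x_i}(f_i(x_i,\operatorname{avg}(\boldsymbol x),\xi_i))]\big)_i$ (the average is differentiated too), a v-SGNE is an SGNE $\boldsymbol x^*$ for which there are $v_i\in\partial g_i(x_i^*)$ with $\sum_i\langle\mathbb F_i(\boldsymbol x^*)+v_i,y_i-x_i^*\rangle\ge0$ for all $\boldsymbol y\in\boldsymbol{\mathcal X}$. **Assumptions.** (1) $f_i(x,y,\cdot)$ is measurable; for every $\xi_i\in\Xi_i$, $(x,y)\mapsto f_i(x,y,\xi_i)$ is differentiable, and $f_i(x_i,\operatorname{avg}(\boldsymbol x),\xi_i)$ is convex in $x_i\in\Omega_i$ for every fixed $\boldsymbol x_{-i}$ that is part of a point of $\boldsymbol{\mathcal X}$. With $G_i(x,y,\xi_i):=\nabla_xf_i(x,y,\xi_i)+\frac1N\nabla_yf_i(x,y,\xi_i)$, the expectations of $f_i(x_i,\operatorname{avg}(\boldsymbol x),\xi_i)$ for $\boldsymbol x\in\boldsymbol\Omega$, and $\mathbb F^a_i(x,y):=\mathbb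 E[G_i(x,y,\xi_i)]$ for all $x,y\in\mathbb R^{\bar n}$, are well defined. (2) $\mathbb F$ is strongly monotone on $\boldsymbol\Omega$ and Lipschitz continuous on $\mathbb R^{N\bar n}$. (3) The agents communicate over a connected undirected graph with neighbour sets $\mathcal N_i$ and weights $w_{ij}=w_{ji}>0$ on the edges. (4) At iteration $k$ there are $M_k\geq1$ samples $\xi^{k,t}$, $t=1,\dots,M_k$; all samples are independent with law $\mathbb P$ and jointly independent of the (possibly random) initial point; and for some $c,k_0,a>0$, $M_k\ge c(k+k_0)^{a+1}$ for all $k\ge1$. (5) For every $R$ there is $\sigma>0$ with $\mathbb E\|G_i(x,y,\xi_i)-\mathbb F^a_i(x,y)\|^2\le\sigma^2$ for all $i$, all $x\in\Omega_i$ and all $\|y\|\le R$. **Algorithm (node-based, aggregative).** Start from $x_i^0\in\Omega_i$, $s_i^0=0$, $z_i^0\in\mathbb R^m$, $\lambda_i^0\in\mathbb R^m_{\ge0}$. With $u_i^k=x_i^k+s_i^k$ (so that $s_i$ tracks $\operatorname{avg}(\boldsymbol x)-x_i$), iterate $$\begin{aligned} x_i^{k+1}&=\operatorname{prox}_{\alpha_ig_i}\Big[x_i^k-\alpha_i\Big(\tfrac1{M_k}\sum_{t=1}^{M_k}G_i(x_i^k,u_i^k,\xi_i^{k,t})+A_i^\top\lambda_i^k+\sum_{j\in\mathcal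 N_i}w_{ij}(u_i^k-u_j^k)\Big)\Big],\\ s_i^{k+1}&=s_i^k-\gamma_i\sum_{j\in\mathcal N_i}w_{ij}(u_i^k-u_j^k),\\ z_i^{k+1}&=z_i^k+\nu_i\sum_{j\in\mathcal N_i}w_{ij}(\lambda_i^k-\lambda_j^k),\\ \lambda_i^{k+1}&=\operatorname{proj}_{\mathbb R^m_{\ge0}}\Big[\lambda_i^k+\delta_i\big(A_i(2x_i^{k+1}-x_i^k)-b_i\big)-\delta_i\sum_{j\in\mathcal N_i}w_{ij}\big(2(z_i^{k+1}-z_j^{k+1})-(z_i^k-z_j^k)\big)\Big], \end{aligned}$$ where $\operatorname{prox}_{\alpha g}[v]=\arg\min_p\{\alpha g(p)+\frac12\|p-v\|^2\}$. **Theorem 3.** Under these assumptions the game has exactly one v-SGNE $\boldsymbol x^*$, and there exist $\bar\alpha,\bar\nu,\bar\delta>0$ and $\gamma_i>0$, $i=1,\dots,N$, such that for all $\alpha_i\in(0,\bar\alpha)$, $\nu_i\in(0,\bar\nu)$, $\delta_i\in(0,\bar\delta)$, every sequence $(\boldsymbol x^k)_{k\in\mathbb N}$ generated by the algorithm converges almost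 surely to $\boldsymbol x^*$. The constants $\bar\alpha,\bar\nu,\bar\delta,\gamma_i$ depend only on the game and the weighted graph, not on the samples, the batch sizes or the initial point. -/

import Mathlib

open MeasureTheory ProbabilityTheory Filter Topology

/-- `ℝᵏ` with its Euclidean norm. -/
abbrev Vec (k : ℕ) : Type := EuclideanSpace ℝ (Fin k)

/-- Data of a stochastic aggregative generalized game with `N` agents, decisions in `ℝⁿ`, and
`m` affine coupling constraints `∑ i, A i (x i) ≤ ∑ i, b i`.

The nonsmooth part of the cost of agent `i` is the extended-valued function equal to `g i` on
`Ω i` and to `+∞` outside `Ω i`, so that its domain is `Ω i`; the values of the real function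
`g i` outside `Ω i` are never used.  The smooth part is `f i (x i) (avg x) (ξ i)`, where
`(ξ i)_i` is distributed according to `P` (its components may be dependent). -/
structure AggregativeGame (N n m : ℕ) (Ξ : Fin N → Type*) [∀ i, MeasurableSpace (Ξ i)] where
  Ω : Fin N → Set (Vec n)
  g : Fin N → Vec n → ℝ
  f : (i : Fin N) → Vec n → Vec n → Ξ i → ℝ
  A : Fin N → (Vec n →L[ℝ] Vec m)
  b : Fin N → Vec m
  P : Measure (∀ i, Ξ i)

/-- The average of a family of decisions. -/
noncomputable def avg {N n : ℕ} (x : Fin N → Vec n) : Vec n := (1 / (N : ℝ)) • ∑ i, x i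

namespace AggregativeGame

variable {N n m : ℕ} {Ξ : Fin N → Type*} [∀ i, MeasurableSpace (Ξ i)]

/-- The collective feasible set. -/
def feasible (𝒢 : AggregativeGame N n m Ξ) : Set (Fin N → Vec n) :=
  {x | (∀ i, x i ∈ 𝒢.Ω i) ∧ ∀ r, (∑ i, 𝒢.A i (x i)) r ≤ (∑ i, 𝒢.b i) r}

/-- The feasible set of agent `i`, given the decisions `x j`, `j ≠ i`. -/
def agentFeasible (𝒢 : AggregativeGame N n m Ξ) (x : Fin N → Vec n) (i : Fin N) : Set (Vec n) :=
  {t | t ∈ 𝒢.Ω i ∧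
    ∀ r, (𝒢.A i t) r ≤ (∑ j, 𝒢.b j - ∑ j ∈ Finset.univ.erase i, 𝒢.A j (x j)) r}

/-- The expected cost of agent `i` at a profile in `∏ i, Ω i`. -/
noncomputable def cost (𝒢 : AggregativeGame N n m Ξ) (i : Fin N) (x : Fin N → Vec n) : ℝ :=
  (∫ ξ, 𝒢.f i (x i) (avg x) (ξ i) ∂𝒢.P) + 𝒢.g i (x i)

/-- Stochastic generalized Nash equilibrium. -/
def IsSGNE (𝒢 : AggregativeGame N n m Ξ) (x : Fin N → Vec n) : Prop :=
  x ∈ 𝒢.feasible ∧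
    ∀ i, ∀ t ∈ 𝒢.agentFeasible x i, 𝒢.cost i x ≤ 𝒢.cost i (Function.update x i t)

/-- The pseudogradient mapping: component `i` is the expected gradient of the smooth part of the
cost of agent `i` with respect to the decision of agent `i` (which also moves the average). -/
noncomputable def pseudograd (𝒢 : AggregativeGame N n m Ξ) (x : Fin N → Vec n) (i : Fin N) :
    Vec n :=
  ∫ ξ, gradient (fun t => 𝒢.f i t (avg (Function.update x i t)) (ξ i)) (x i) ∂𝒢.P

/-- `∇ₓ fᵢ(x, y, ξ) + (1/N) ∇_y fᵢ(x, y, ξ)`: the sampled gradient of agent `i` at its decision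
`x` and its approximation `y` of the average. -/
noncomputable def sampleGrad (𝒢 : AggregativeGame N n m Ξ) (i : Fin N) (x y : Vec n) (ξ : Ξ i) :
    Vec n :=
  gradient (fun t => 𝒢.f i t y ξ) x + (1 / (N : ℝ)) • gradient (fun t => 𝒢.f i x t ξ) y

/-- The extended pseudogradient mapping of the aggregative game, component `i`. -/
noncomputable def extPseudograd (𝒢 : AggregativeGame N n m Ξ) (i : Fin N) (x y : Vec n) : Vec n :=
  ∫ ξ, 𝒢.sampleGrad i x y (ξ i) ∂𝒢.P

/-- The subdifferential at `x` of the extended-valued function equal to `g i` on `Ω i` and to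
`+∞` elsewhere. -/
def subdiff (𝒢 : AggregativeGame N n m Ξ) (i : Fin N) (x : Vec n) : Set (Vec n) :=
  {v | x ∈ 𝒢.Ω i ∧ ∀ y ∈ 𝒢.Ω i, 𝒢.g i x + inner ℝ v (y - x) ≤ 𝒢.g i y}

/-- Solutions of the stochastic variational inequality of the set-valued mapping `F + ∏ i, ∂gᵢ`
over the collective feasible set. -/
def SolvesSVI (𝒢 : AggregativeGame N n m Ξ) (x : Fin N → Vec n) : Prop :=
  x ∈ 𝒢.feasible ∧ ∃ v : Fin N → Vec n, (∀ i, v i ∈ 𝒢.subdiff i (x i)) ∧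
    ∀ y ∈ 𝒢.feasible, 0 ≤ ∑ i, inner ℝ (𝒢.pseudograd x i + v i) (y i - x i)

/-- Variational equilibrium: an equilibrium that also solves the variational inequality. -/
def IsVSGNE (𝒢 : AggregativeGame N n m Ξ) (x : Fin N → Vec n) : Prop :=
  𝒢.IsSGNE x ∧ 𝒢.SolvesSVI x

/-- Standing assumptions on the game. -/
structure Assumptions (𝒢 : AggregativeGame N n m Ξ) : Prop where
  isProbabilityMeasure : IsProbabilityMeasure 𝒢.P
  nonempty : ∀ i, (𝒢.Ω i).Nonempty
  isCompact : ∀ i, IsCompact (𝒢.Ω i)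
  convex : ∀ i, Convex ℝ (𝒢.Ω i)
  g_convex : ∀ i, ConvexOn ℝ (𝒢.Ω i) (𝒢.g i)
  g_lsc : ∀ i, LowerSemicontinuousOn (𝒢.g i) (𝒢.Ω i)
  /-- Slater's constraint qualification. -/
  slater : ∃ x : Fin N → Vec n, (∀ i, x i ∈ 𝒢.Ω i) ∧
    ∀ r, (∑ i, 𝒢.A i (x i)) r < (∑ i, 𝒢.b i) r
  f_measurable : ∀ i x y, Measurable (𝒢.f i x y)
  /-- Differentiability in the pair (decision, aggregate); implied by continuous
  differentiability. -/
  f_differentiable : ∀ i (ξ : Ξ i), Differentiable ℝ (fun p : Vec n × Vec n => 𝒢.f i p.1 p.2 ξ)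
  f_convex : ∀ x ∈ 𝒢.feasible, ∀ i (ξ : Ξ i),
    ConvexOn ℝ (𝒢.Ω i) (fun t => 𝒢.f i t (avg (Function.update x i t)) ξ)
  /-- The expected costs are well defined. -/
  f_integrable : ∀ x : Fin N → Vec n, (∀ i, x i ∈ 𝒢.Ω i) →
    ∀ i, Integrable (fun ξ => 𝒢.f i (x i) (avg x) (ξ i)) 𝒢.P
  /-- The expected gradients are well defined. -/
  grad_integrable : ∀ i x y, Integrable (fun ξ => 𝒢.sampleGrad i x y (ξ i)) 𝒢.P
  /-- The pseudogradient is strongly monotone. -/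
  strongly_monotone : ∃ η : ℝ, 0 < η ∧ ∀ x y : Fin N → Vec n,
    (∀ i, x i ∈ 𝒢.Ω i) → (∀ i, y i ∈ 𝒢.Ω i) →
    η * ∑ i, ‖x i - y i‖ ^ 2 ≤ ∑ i, inner ℝ (𝒢.pseudograd x i - 𝒢.pseudograd y i) (x i - y i)
  /-- The pseudogradient is Lipschitz continuous (for the Euclidean norm of `ℝ^(N n)`). -/
  lipschitz : ∃ l : ℝ, 0 < l ∧ ∀ x y : Fin N → Vec n,
    ∑ i, ‖𝒢.pseudograd x i - 𝒢.pseudograd y i‖ ^ 2 ≤ l ^ 2 * ∑ i, ‖x i - y i‖ ^ 2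
  /-- The variance of a sampled gradient is bounded, uniformly for decisions in `Ω i` and
  approximated averages in a bounded set. -/
  variance : ∀ R : ℝ, ∃ σ : ℝ, 0 < σ ∧ ∀ i, ∀ x ∈ 𝒢.Ω i, ∀ y : Vec n, ‖y‖ ≤ R →
    ∫⁻ ξ, ‖𝒢.sampleGrad i x y (ξ i) - 𝒢.extPseudograd i x y‖ₑ ^ 2 ∂𝒢.P ≤ ENNReal.ofReal (σ ^ 2)

end AggregativeGame

/-- `p = prox_{a g}(v)`, where `g` is understood as `+∞` outside `S`. -/
def IsProx {n : ℕ} (S : Set (Vec n)) (g : Vec n → ℝ) (a : ℝ) (v p : Vec n) : Prop :=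
  p ∈ S ∧ ∀ y ∈ S, a * g p + ‖p - v‖ ^ 2 / 2 ≤ a * g y + ‖y - v‖ ^ 2 / 2

/-- The Euclidean projection onto the nonnegative orthant of `ℝᵐ`. -/
noncomputable def projNonneg {m : ℕ} (v : Vec m) : Vec m := WithLp.toLp 2 (fun r => max (v r) 0)

/-- `∑_{j ∈ 𝒩ᵢ} wᵢⱼ (yᵢ - yⱼ)`: block `i` of the weighted Laplacian applied to `y`. -/
noncomputable def graphLap {N k : ℕ} (G : SimpleGraph (Fin N)) [DecidableRel G.Adj]
    (w : Fin N → Fin N → ℝ) (y : Fin N → Vec k) (i : Fin N) : Vec k :=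
  ∑ j ∈ G.neighborFinset i, w i j • (y i - y j)

/-- Increasing batch sizes. -/
def BatchGrowth (M : ℕ → ℕ) : Prop :=
  (∀ k, 0 < M k) ∧ ∃ c k₀ a : ℝ, 0 < c ∧ 0 < k₀ ∧ 0 < a ∧
    ∀ k : ℕ, 1 ≤ k → c * ((k : ℝ) + k₀) ^ (a + 1) ≤ (M k : ℝ)

/-- The processes `(x, s, z, lam)` are generated by the node-based algorithm for aggregative games
with step sizes `α, γ, ν, δ`, where at iteration `k` the gradients are approximated with the
`M k` samples `ζ k t`, and agent `i` uses the components `ζ k t ω i`. -/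
structure IsNodeRun {N n m : ℕ} {Ξ : Fin N → Type*} [∀ i, MeasurableSpace (Ξ i)]
    (𝒢 : AggregativeGame N n m Ξ) (G : SimpleGraph (Fin N)) [DecidableRel G.Adj]
    (w : Fin N → Fin N → ℝ) (α γ ν δ : Fin N → ℝ) {S : Type*} (M : ℕ → ℕ)
    (ζ : (k : ℕ) → Fin (M k) → S → (∀ i, Ξ i))
    (x s : ℕ → S → Fin N → Vec n) (z lam : ℕ → S → Fin N → Vec m) : Prop where
  init_x : ∀ ω i, x 0 ω i ∈ 𝒢.Ω i
  init_s : ∀ ω i, s 0 ω i = 0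
  init_lam : ∀ ω i r, 0 ≤ lam 0 ω i r
  step_x : ∀ k ω i, IsProx (𝒢.Ω i) (𝒢.g i) (α i)
    (x k ω i - α i •
      ((1 / (M k : ℝ)) • ∑ t : Fin (M k), 𝒢.sampleGrad i (x k ω i) (x k ω i + s k ω i) (ζ k t ω i)
        + (𝒢.A i).adjoint (lam k ω i) + graphLap G w (x k ω + s k ω) i))
    (x (k + 1) ω i)
  step_s : ∀ k ω i, s (k + 1) ω i = s k ω i - γ i • graphLap G w (x k ω + s k ω) i
  step_z : ∀ k ω i, z (k + 1) ω i = z k ω i + ν i • graphLap G w (lam k ω) i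
  step_lam : ∀ k ω i, lam (k + 1) ω i = projNonneg (lam k ω i
    + δ i • (𝒢.A i ((2 : ℝ) • x (k + 1) ω i - x k ω i) - 𝒢.b i)
    - δ i • ((2 : ℝ) • graphLap G w (z (k + 1) ω) i - graphLap G w (z k ω) i))

/-! Existence and uniqueness. A small projected-type step `x ↦ prox(x - τ F x)` on the compact
feasible set is a contraction, and its fixed point solves the variational inequality
(`exists_mixed_variational_inequality`). That point minimizes a convex function over the coupling
constraints, so Slater's condition yields a multiplier common to all agents
(`exists_lagrange_multiplier`, `exists_isKKT`). KKT points solve the variational inequality, its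
solutions are equilibria because the gradient inequality may be integrated, and strong monotonicity
leaves at most one solution.

Descent. For a fixed sample path the algorithm is a preconditioned primal-dual forward-backward
step. For small steps the form `precondForm` is nonnegative, and it decreases up to the error of the
forward term (`precondForm_descent`, `precondForm_lower`). This error has two sources. The first is
the disagreement `u - mean u`: tracking preserves the mean, and a gossip step contracts the
disagreement up to the primal increment. Adding a multiple of its square to the form absorbs it,
because the extended pseudogradient is Lipschitz in the estimate of the average
(`profExtGrad_lipschitz`). The second is the sampling error `ε`, which contributes `‖ε‖² - 2⟪ε, x -
x*⟫`. Summation bounds `η ∑ ‖x k - x*‖²` by a function of the initial point plus these contributions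
(`exists_stepsizes`).

Probability. The decisions live in a compact set and the disagreement obeys a contractive recursion,
so the estimates `u` stay in a fixed ball and the sampling variance is uniformly bounded. The
current batch is independent of the initial point and of the past, so the cross term integrates to
zero over any event determined by the initial point, while `‖ε‖²` has mean of order `1 / M k`, which
is summable. The initial point may have no moments, so expectations are taken on the events where
the initial Lyapunov value is at most `R`. There `∑ ‖x k - x*‖²` has finite expectation, hence is
finite almost surely; these events exhaust the space (`ae_tendsto_zero_of_noisy_descent`). No
martingale convergence theorem is needed. -/

/-! ### Proximal points and mixed variational inequalities. -/

section Prox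

theorem exists_prox {E : Type*} [NormedAddCommGroup E] {S : Set E} (hS : IsCompact S) (hne : S.Nonempty)
    {h : E → ℝ} (hl : LowerSemicontinuousOn h S) (v : E) :
    ∃ p ∈ S, ∀ y ∈ S, h p + ‖p - v‖ ^ 2 / 2 ≤ h y + ‖y - v‖ ^ 2 / 2 := by
  have hc : LowerSemicontinuousOn (fun y => ‖y - v‖ ^ 2 / 2) S :=
    (show Continuous fun y => ‖y - v‖ ^ 2 / 2 by fun_prop).continuousOn.lowerSemicontinuousOn
  obtain ⟨p, hp, hmin⟩ := (hl.add hc).exists_isMinOn hne hS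
  exact ⟨p, hp, fun y hy => hmin hy⟩

variable {E : Type*} [NormedAddCommGroup E] [InnerProductSpace ℝ E]

/-- Minimality is tested along the segment from `p` to `y`: at parameter `t`, a violation `d` gains
`t * d` by convexity while the quadratic term costs only `t² * q / 2`. -/
theorem prox_variational {S : Set E} {h : E → ℝ} (hh : ConvexOn ℝ S h) {v p : E} (hp : p ∈ S)
    (hmin : ∀ y ∈ S, h p + ‖p - v‖ ^ 2 / 2 ≤ h y + ‖y - v‖ ^ 2 / 2) :
    ∀ y ∈ S, h p + inner ℝ (v - p) (y - p) ≤ h y := by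
  intro y hy
  by_contra! hlt
  set q := ‖y - p‖ ^ 2 with hq
  have hq0 : 0 ≤ q := by positivity
  set d := h p + inner ℝ (v - p) (y - p) - h y with hd
  have hd0 : 0 < d := by linarith
  have key : ∀ t : ℝ, 0 < t → t ≤ 1 → d ≤ t * q / 2 := by
    intro t ht ht1
    have hmem : (1 - t) • p + t • y ∈ S :=
      hh.1 hp hy (by linarith) ht.le (by ring)
    have h1 := hmin _ hmem
    have h2 := hh.2 hp hy (by linarith : 0 ≤ 1 - t) ht.le (by ring)
    have h3 : ‖(1 - t) • p + t • y - v‖ ^ 2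
        = ‖p - v‖ ^ 2 - 2 * t * inner ℝ (v - p) (y - p) + t ^ 2 * q := by
      have : (1 - t) • p + t • y - v = (p - v) + t • (y - p) := by module
      rw [this, norm_add_sq_real, norm_smul, inner_smul_right, mul_pow, Real.norm_eq_abs, sq_abs,
        ← neg_sub v p, inner_neg_left, norm_neg]
      ring
    rw [h3] at h1
    simp only [smul_eq_mul] at h2
    have h4 : t * d ≤ t * (t * q / 2) := by
      rw [hd]; nlinarith
    exact le_of_mul_le_mul_left h4 ht
  have h1 := key 1 one_pos le_rfl
  -- This `t` makes the bound strictly smaller than `d`; the `+ 1` covers `q = 0`, and `h1`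
  -- guarantees `t ≤ 1`.
  have h2 := key (d / (q + 1)) (by positivity) (by rw [div_le_one (by positivity)]; linarith)
  have h3 : d / (q + 1) * q / 2 < d := by
    rw [div_mul_eq_mul_div, div_div, div_lt_iff₀ (by positivity)]
    nlinarith
  linarith

/-- Testing each variational inequality at the other proximal point and adding gives firm
nonexpansiveness. With `v = v'` it also shows that proximal points are unique. -/
theorem norm_sub_sq_le_of_prox {S : Set E} {h : E → ℝ} (hh : ConvexOn ℝ S h) {v p v' p' : E}
    (hp : p ∈ S) (hmin : ∀ y ∈ S, h p + ‖p - v‖ ^ 2 / 2 ≤ h y + ‖y - v‖ ^ 2 / 2)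
    (hp' : p' ∈ S) (hmin' : ∀ y ∈ S, h p' + ‖p' - v'‖ ^ 2 / 2 ≤ h y + ‖y - v'‖ ^ 2 / 2) :
    ‖p - p'‖ ≤ ‖v - v'‖ := by
  have h1 := prox_variational hh hp hmin p' hp'
  have h2 := prox_variational hh hp' hmin' p hp
  have h3 : ‖p - p'‖ ^ 2 ≤ inner ℝ (v - v') (p - p') := by
    have e1 : inner ℝ (v - p) (p' - p) + inner ℝ (v' - p') (p - p')
        = ‖p - p'‖ ^ 2 - inner ℝ (v - v') (p - p') := by
      rw [← real_inner_self_eq_norm_sq, ← neg_sub p p', inner_neg_right]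
      simp only [inner_sub_left, inner_sub_right]
      ring
    linarith
  have h4 := real_inner_le_norm (v - v') (p - p')
  by_contra! hlt
  nlinarith [norm_nonneg (v - v'), norm_nonneg (p - p')]

/-- Banach's fixed point theorem for `x ↦ prox_{τ h}(x - τ F x)`. The squared contraction factor `1
- 2 τ η + τ² l²` is minimized at `τ = η / l²`, with value `c = 1 - η² / l²`. The variational
characterization of the proximal point at the fixed point is the claim. -/
theorem exists_mixed_variational_inequality {S : Set E} (hS : IsCompact S) (hne : S.Nonempty)
    {h : E → ℝ} (hl : LowerSemicontinuousOn h S) (hh : ConvexOn ℝ S h) {F : E → E} {η l : ℝ}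
    (hη : 0 < η) (hl0 : 0 < l)
    (hmono : ∀ x ∈ S, ∀ y ∈ S, η * ‖x - y‖ ^ 2 ≤ inner ℝ (F x - F y) (x - y))
    (hlip : ∀ x y, ‖F x - F y‖ ^ 2 ≤ l ^ 2 * ‖x - y‖ ^ 2) :
    ∃ x ∈ S, ∀ y ∈ S, h x ≤ h y + inner ℝ (F x) (y - x) := by
  set τ := η / l ^ 2 with hτ
  have hτ0 : 0 < τ := by positivity
  have hlτ : LowerSemicontinuousOn (fun y => τ * h y) S := fun x hx a ha => by
    have : a / τ < h x := by rwa [div_lt_iff₀ hτ0, mul_comm]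
    filter_upwards [hl x hx _ this] with y hy
    rwa [gt_iff_lt, div_lt_iff₀ hτ0, mul_comm] at hy
  have hhτ : ConvexOn ℝ S (fun y => τ * h y) := hh.smul hτ0.le
  choose T hTS hTmin using fun x : S => exists_prox hS hne hlτ ((x : E) - τ • F x)
  set c := 1 - η ^ 2 / l ^ 2 with hc
  have hcontr : ContractingWith (Real.toNNReal (Real.sqrt c)) (fun x : S => (⟨T x, hTS x⟩ : S)) := by
    refine ⟨?_, LipschitzWith.of_dist_le_mul fun x y => ?_⟩
    · rw [Real.toNNReal_lt_one, Real.sqrt_lt' one_pos, hc]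
      have : 0 < η ^ 2 / l ^ 2 := by positivity
      linarith
    · rw [Real.coe_toNNReal _ (Real.sqrt_nonneg _), Subtype.dist_eq, Subtype.dist_eq, dist_eq_norm,
        dist_eq_norm]
      refine (norm_sub_sq_le_of_prox hhτ (hTS x) (hTmin x) (hTS y) (hTmin y)).trans ?_
      have e : ((x : E) - τ • F x) - ((y : E) - τ • F y) = ((x : E) - y) - τ • (F x - F y) := by
        module
      have : ‖((x : E) - τ • F x) - ((y : E) - τ • F y)‖ ^ 2 ≤ c * ‖(x : E) - y‖ ^ 2 := by
        rw [e, norm_sub_sq_real, inner_smul_right, norm_smul, mul_pow, Real.norm_eq_abs, sq_abs,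
          real_inner_comm]
        have h1 := hmono x x.2 y y.2
        have h2 := mul_le_mul_of_nonneg_left (hlip x y) (sq_nonneg τ)
        have h3 := mul_le_mul_of_nonneg_left h1 hτ0.le
        have h4 : c * ‖(x : E) - y‖ ^ 2
            = ‖(x : E) - y‖ ^ 2 - 2 * (τ * (η * ‖(x : E) - y‖ ^ 2))
              + τ ^ 2 * (l ^ 2 * ‖(x : E) - y‖ ^ 2) := by
          rw [hc, hτ]; field_simp; ring
        linarith
      rw [← Real.sqrt_sq (norm_nonneg ((x : E) - y)), ← Real.sqrt_mul' _ (sq_nonneg _)]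
      exact Real.le_sqrt_of_sq_le this
  have : CompleteSpace S := hS.isComplete.completeSpace_coe
  have : Nonempty S := hne.to_subtype
  set x := hcontr.fixedPoint with hx
  have hfix : T x = x := congrArg Subtype.val hcontr.fixedPoint_isFixedPt
  refine ⟨x, x.2, fun y hy => ?_⟩
  have h1 := prox_variational hhτ (hTS x) (hTmin x) y hy
  rw [hfix] at h1
  have e : (x : E) - τ • F x - x = -(τ • F x) := by abel
  rw [e, inner_neg_left, real_inner_smul_left] at h1
  have h2 : τ * h x ≤ τ * (h y + inner ℝ (F x) (y - x)) := by linarith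
  exact le_of_mul_le_mul_left h2 hτ0

end Prox

/-! ### Convex duality under Slater's condition. -/

/-- Optimality of `x₀` means that the origin lies outside the open convex set `C` of strict upper
bounds on (constraints, objective increase). A separating functional has nonpositive coefficients,
and Slater's condition makes the objective coefficient nonzero, so one may divide by it. -/
theorem exists_lagrange_multiplier {E : Type*} [AddCommGroup E] [Module ℝ E] {m : ℕ} {S : Set E}
    {φ : E → ℝ} (hφ : ConvexOn ℝ S φ) {c : Fin m → E → ℝ} (hc : ∀ r, ConvexOn ℝ S (c r))
    {x₀ : E} (hx₀ : x₀ ∈ S) (hfeas : ∀ r, c r x₀ ≤ 0)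
    (hmin : ∀ y ∈ S, (∀ r, c r y ≤ 0) → φ x₀ ≤ φ y) (hslater : ∃ y ∈ S, ∀ r, c r y < 0) :
    ∃ lam : Fin m → ℝ, (∀ r, 0 ≤ lam r) ∧ ∑ r, lam r * c r x₀ = 0 ∧
      ∀ y ∈ S, φ x₀ ≤ φ y + ∑ r, lam r * c r y := by
  set C : Set ((Fin m → ℝ) × ℝ) :=
    {p | ∃ y ∈ S, (∀ r, c r y < p.1 r) ∧ φ y - φ x₀ < p.2} with hC
  have hopen : IsOpen C := by
    have : C = ⋃ y ∈ S, ((⋂ r, {p : (Fin m → ℝ) × ℝ | c r y < p.1 r}) ∩ {p | φ y - φ x₀ < p.2}) := by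
      ext p; simp [hC, and_left_comm]
    rw [this]
    refine isOpen_biUnion fun y _ => IsOpen.inter (isOpen_iInter_of_finite fun r => ?_) ?_
    · exact isOpen_lt continuous_const (by fun_prop)
    · exact isOpen_lt continuous_const (by fun_prop)
  have hconv : Convex ℝ C := by
    rintro p ⟨y, hy, h1, h2⟩ p' ⟨y', hy', h1', h2'⟩ s t hs ht hst
    refine ⟨s • y + t • y', hφ.1 hy hy' hs ht hst, fun r => ?_, ?_⟩
    · refine ((hc r).2 hy hy' hs ht hst).trans_lt ?_
      simp only [smul_eq_mul, Prod.fst_add, Prod.smul_fst, Pi.add_apply, Pi.smul_apply]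
      rcases hs.eq_or_lt with rfl | hs'
      · obtain rfl : t = 1 := by linarith
        simpa using h1' r
      · nlinarith [mul_lt_mul_of_pos_left (h1 r) hs', mul_le_mul_of_nonneg_left (h1' r).le ht]
    · have := hφ.2 hy hy' hs ht hst
      simp only [smul_eq_mul, Prod.snd_add, Prod.smul_snd] at this ⊢
      rcases hs.eq_or_lt with rfl | hs'
      · obtain rfl : t = 1 := by linarith
        simp at this ⊢; linarith
      · have e : φ x₀ = s * φ x₀ + t * φ x₀ := by rw [← add_mul, hst, one_mul]
        nlinarith [mul_lt_mul_of_pos_left h2 hs', mul_le_mul_of_nonneg_left h2'.le ht]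
  have h0 : (0 : (Fin m → ℝ) × ℝ) ∉ C := by
    rintro ⟨y, hy, h1, h2⟩
    have := hmin y hy fun r => (h1 r).le
    simp at h2; linarith
  obtain ⟨f, hf⟩ := geometric_hahn_banach_open_point hconv hopen h0
  simp only [map_zero] at hf
  set f₀ := f (0, 1) with hf₀
  set fr : Fin m → ℝ := fun r => f (Pi.single r 1, 0) with hfr
  have hfexp : ∀ p : Fin m → ℝ, ∀ t : ℝ, f (p, t) = ∑ r, p r * fr r + t * f₀ := by
    intro p t
    have : ((p, t) : (Fin m → ℝ) × ℝ)
        = ∑ r, p r • ((Pi.single r 1 : Fin m → ℝ), (0 : ℝ)) + t • ((0 : Fin m → ℝ), (1 : ℝ)) := by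
      ext
      · simp [Prod.fst_sum, Finset.sum_apply, Pi.single_apply]
      · simp [Prod.snd_sum]
    rw [this, map_add, map_sum]
    simp only [map_smul, smul_eq_mul, hfr, hf₀]
  obtain ⟨ys, hys, hslat⟩ := hslater
  have hf₀neg : f₀ < 0 := by
    have := hf (0, |φ ys - φ x₀| + 1) ⟨ys, hys, by simpa using hslat, by
      show _ < |φ ys - φ x₀| + 1
      linarith [le_abs_self (φ ys - φ x₀)]⟩
    rw [hfexp] at this
    simp only [Pi.zero_apply, zero_mul, Finset.sum_const_zero, zero_add] at this
    by_contra! hge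
    have : 0 ≤ (|φ ys - φ x₀| + 1) * f₀ := by positivity
    linarith
  have hfrneg : ∀ r, fr r ≤ 0 := by
    intro r
    by_contra! hpos
    -- If `fr r > 0`, moving along coordinate `r` by `-B / fr r ≥ 0` stays in `C` and brings the
    -- functional exactly to `0`, against its strict negativity on `C`.
    set B := (|φ ys - φ x₀| + 1) * f₀ with hB
    have hmem : ((Pi.single r (-B / fr r) : Fin m → ℝ), |φ ys - φ x₀| + 1) ∈ C := by
      refine ⟨ys, hys, fun r' => ?_, ?_⟩
      · refine (hslat r').trans_le ?_
        have hBneg : 0 ≤ -B / fr r := by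
          apply div_nonneg _ hpos.le
          rw [hB]; nlinarith [abs_nonneg (φ ys - φ x₀)]
        simp only [Pi.single_apply]
        split_ifs <;> simp [hBneg]
      · show _ < |φ ys - φ x₀| + 1
        linarith [le_abs_self (φ ys - φ x₀)]
    have := hf _ hmem
    rw [hfexp] at this
    simp only [Pi.single_apply, ite_mul, zero_mul, Finset.sum_ite_eq', Finset.mem_univ, if_true,
      ← hB] at this
    rw [div_mul_cancel₀ _ hpos.ne'] at this
    linarith
  have hlag : ∀ y ∈ S, φ x₀ ≤ φ y + ∑ r, (fr r / f₀) * c r y := by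
    intro y hy
    have h1 : ∀ ε : ℝ, 0 < ε →
        ∑ r, c r y * fr r + (φ y - φ x₀) * f₀ + ε * (∑ r, fr r + f₀) < 0 := by
      intro ε hε
      have := hf (fun r => c r y + ε, φ y - φ x₀ + ε) ⟨y, hy, fun r => by simp [hε], by simp [hε]⟩
      rw [hfexp] at this
      simp only [add_mul, Finset.sum_add_distrib, ← Finset.mul_sum] at this
      linarith
    have h2 : ∑ r, c r y * fr r + (φ y - φ x₀) * f₀ ≤ 0 := by
      have ht : Tendsto (fun ε : ℝ => ∑ r, c r y * fr r + (φ y - φ x₀) * f₀ + ε * (∑ r, fr r + f₀))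
          (𝓝[>] 0) (𝓝 (∑ r, c r y * fr r + (φ y - φ x₀) * f₀ + 0 * (∑ r, fr r + f₀))) :=
        (Continuous.tendsto (by fun_prop) _).mono_left nhdsWithin_le_nhds
      rw [zero_mul, add_zero] at ht
      refine le_of_tendsto ht ?_
      filter_upwards [self_mem_nhdsWithin] with ε hε using (h1 ε hε).le
    have h3 : ∑ r, (fr r / f₀) * c r y = (∑ r, c r y * fr r) / f₀ := by
      rw [Finset.sum_div]; exact Finset.sum_congr rfl fun r _ => by ring
    have h4 : 0 ≤ (∑ r, c r y * fr r + (φ y - φ x₀) * f₀) / f₀ :=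
      div_nonneg_of_nonpos h2 hf₀neg.le
    rw [add_div, mul_div_assoc, div_self hf₀neg.ne, mul_one] at h4
    rw [h3]; linarith
  have hnn : ∀ r, 0 ≤ fr r / f₀ := fun r => div_nonneg_of_nonpos (hfrneg r) hf₀neg.le
  refine ⟨fun r => fr r / f₀, hnn, le_antisymm ?_ ?_, hlag⟩
  · exact Finset.sum_nonpos fun r _ => mul_nonpos_of_nonneg_of_nonpos (hnn r) (hfeas r)
  · linarith [hlag x₀ hx₀]

/-- Families of `N` vectors of `ℝᵏ` with the Euclidean norm of `ℝ^(N k)`. -/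
abbrev Prof (N k : ℕ) : Type := PiLp 2 (fun _ : Fin N => Vec k)

/-! ### Averaging and the consensus subspace. -/

section Mean

variable {N k : ℕ}

theorem avg_add (x y : Fin N → Vec k) : avg (x + y) = avg x + avg y := by
  simp [avg, Finset.sum_add_distrib]

theorem avg_smul (c : ℝ) (x : Fin N → Vec k) : avg (c • x) = c • avg x := by
  simp [avg, ← Finset.smul_sum, smul_comm c]

theorem avg_const (hN : 0 < N) (v : Vec k) : avg (fun _ : Fin N => v) = v := by
  have : (N : ℝ) ≠ 0 := by positivity
  simp [avg, ← Nat.cast_smul_eq_nsmul ℝ, smul_smul, this]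

theorem sum_eq_smul_avg (hN : 0 < N) (x : Fin N → Vec k) : ∑ i, x i = (N : ℝ) • avg x := by
  have : (N : ℝ) ≠ 0 := by positivity
  simp [avg, smul_smul, this]

/-- The projection onto the consensus subspace. -/
noncomputable def meanCLM (N k : ℕ) : Prof N k →L[ℝ] Prof N k where
  toFun y := WithLp.toLp 2 (fun _ => avg y)
  map_add' x y := by
    ext i : 1
    exact avg_add x y
  map_smul' c x := by
    ext i : 1
    exact avg_smul c x
  cont := by unfold avg; fun_prop

theorem meanCLM_apply (y : Prof N k) (i : Fin N) : meanCLM N k y i = avg y := rfl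

theorem meanCLM_eq_zero_iff (hN : 0 < N) (y : Prof N k) : meanCLM N k y = 0 ↔ ∑ i, y i = 0 := by
  rw [sum_eq_smul_avg hN]
  constructor
  · intro h
    have := congrArg (fun v : Prof N k => v ⟨0, hN⟩) h
    simp only [meanCLM_apply] at this
    simp [this]
  · intro h
    have hN' : (N : ℝ) ≠ 0 := by positivity
    ext i : 1
    rw [meanCLM_apply]
    exact (smul_eq_zero.1 h).resolve_left hN'

theorem meanCLM_meanCLM (hN : 0 < N) (y : Prof N k) :
    meanCLM N k (meanCLM N k y) = meanCLM N k y := by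
  ext i : 1
  exact avg_const hN _

theorem norm_sub_meanCLM_le (hN : 0 < N) (y : Prof N k) : ‖y - meanCLM N k y‖ ≤ ‖y‖ := by
  set z := y - meanCLM N k y with hz
  have h0 : ∑ i, z i = 0 := by
    rw [← meanCLM_eq_zero_iff hN, hz, map_sub, meanCLM_meanCLM hN, sub_self]
  have h1 : inner ℝ z (meanCLM N k y) = 0 := by
    rw [PiLp.inner_apply]
    simp only [meanCLM_apply]
    rw [← sum_inner, h0, inner_zero_left]
  have h2 : ‖y‖ ^ 2 = ‖z‖ ^ 2 + ‖meanCLM N k y‖ ^ 2 := by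
    have : y = z + meanCLM N k y := by rw [hz]; abel
    conv_lhs => rw [this, norm_add_sq_real, h1]
    ring
  exact le_of_sq_le_sq (by nlinarith [sq_nonneg ‖meanCLM N k y‖]) (norm_nonneg _)

end Mean

/-! ### The weighted graph Laplacian. -/

section Laplacian

variable {N k : ℕ} (G : SimpleGraph (Fin N)) [DecidableRel G.Adj] (w : Fin N → Fin N → ℝ)

/-- The weighted adjacency matrix. -/
noncomputable def adjWeight (i j : Fin N) : ℝ := if G.Adj i j then w i j else 0

theorem graphLap_eq_sum (y : Fin N → Vec k) (i : Fin N) :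
    graphLap G w y i = ∑ j, adjWeight G w i j • (y i - y j) := by
  simp only [graphLap, adjWeight, ite_smul, zero_smul, SimpleGraph.neighborFinset_eq_filter,
    Finset.sum_filter]

theorem adjWeight_comm (hw : ∀ i j, w i j = w j i) (i j : Fin N) :
    adjWeight G w i j = adjWeight G w j i := by
  simp only [adjWeight, G.adj_comm i j, hw i j]

theorem sum_inner_graphLap (hw : ∀ i j, w i j = w j i) (y v : Fin N → Vec k) :
    ∑ i, inner ℝ (graphLap G w y i) (v i)
      = (1 / 2) * ∑ i, ∑ j, adjWeight G w i j * inner ℝ (y i - y j) (v i - v j) := by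
  have h1 : ∑ i, inner ℝ (graphLap G w y i) (v i)
      = ∑ i, ∑ j, adjWeight G w i j * inner ℝ (y i - y j) (v i) := by
    simp only [graphLap_eq_sum, sum_inner, real_inner_smul_left]
  have h2 : ∑ i, ∑ j, adjWeight G w i j * inner ℝ (y i - y j) (v i)
      = ∑ i, ∑ j, adjWeight G w i j * -inner ℝ (y i - y j) (v j) := by
    rw [Finset.sum_comm]
    refine Finset.sum_congr rfl fun i _ => Finset.sum_congr rfl fun j _ => ?_
    rw [adjWeight_comm G w hw, ← inner_neg_left, neg_sub]
  have h3 : ∑ i, ∑ j, adjWeight G w i j * inner ℝ (y i - y j) (v i - v j)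
      = ∑ i, ∑ j, adjWeight G w i j * inner ℝ (y i - y j) (v i)
        + ∑ i, ∑ j, adjWeight G w i j * -inner ℝ (y i - y j) (v j) := by
    simp only [← Finset.sum_add_distrib, inner_sub_right]
    exact Finset.sum_congr rfl fun i _ => Finset.sum_congr rfl fun j _ => by ring
  rw [h1, h3, ← h2]
  ring

/-- The weighted Laplacian as an operator. -/
noncomputable def lapCLM (k : ℕ) : Prof N k →L[ℝ] Prof N k where
  toFun y := WithLp.toLp 2 (graphLap G w y)
  map_add' x y := by
    ext i : 1
    simp only [graphLap, PiLp.add_apply, ← Finset.sum_add_distrib]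
    exact Finset.sum_congr rfl fun j _ => by module
  map_smul' c x := by
    ext i : 1
    simp only [graphLap, PiLp.smul_apply, RingHom.id_apply, Finset.smul_sum]
    exact Finset.sum_congr rfl fun j _ => by module
  cont := by unfold graphLap; fun_prop

theorem lapCLM_apply (y : Prof N k) (i : Fin N) : lapCLM G w k y i = graphLap G w y i := rfl

theorem inner_lapCLM (hw : ∀ i j, w i j = w j i) (y v : Prof N k) :
    inner ℝ (lapCLM G w k y) v
      = (1 / 2) * ∑ i, ∑ j, adjWeight G w i j * inner ℝ (y i - y j) (v i - v j) := by
  rw [PiLp.inner_apply]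
  exact sum_inner_graphLap G w hw y v

theorem lapCLM_symm (hw : ∀ i j, w i j = w j i) (y v : Prof N k) :
    inner ℝ (lapCLM G w k y) v = inner ℝ y (lapCLM G w k v) := by
  rw [← real_inner_comm y, inner_lapCLM G w hw, inner_lapCLM G w hw]
  simp only [real_inner_comm]

theorem lapCLM_const {y : Prof N k} (hy : ∀ i j, y i = y j) : lapCLM G w k y = 0 := by
  ext i : 1
  rw [lapCLM_apply]
  exact Finset.sum_eq_zero fun j _ => by simp [hy i j]

theorem lapCLM_meanCLM (y : Prof N k) : lapCLM G w k (meanCLM N k y) = 0 :=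
  lapCLM_const G w (y := meanCLM N k y) fun _ _ => rfl

theorem sum_lapCLM (hw : ∀ i j, w i j = w j i) (y : Prof N k) : ∑ i, lapCLM G w k y i = 0 := by
  refine ext_inner_right ℝ fun v => ?_
  have := lapCLM_symm G w hw y (WithLp.toLp 2 fun _ => v)
  rw [lapCLM_const G w (y := WithLp.toLp 2 fun _ => v) (fun _ _ => rfl), inner_zero_right, PiLp.inner_apply] at this
  rw [sum_inner, inner_zero_left]
  exact this

variable {G w}

theorem inner_lapCLM_self_nonneg (hw : ∀ i j, w i j = w j i) (hp : ∀ i j, G.Adj i j → 0 < w i j)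
    (y : Prof N k) : 0 ≤ inner ℝ (lapCLM G w k y) y := by
  rw [inner_lapCLM G w hw]
  refine mul_nonneg (by norm_num) (Finset.sum_nonneg fun i _ => Finset.sum_nonneg fun j _ =>
    mul_nonneg ?_ real_inner_self_nonneg)
  rw [adjWeight]; split_ifs with h
  exacts [(hp i j h).le, le_rfl]

/-- The quadratic form is a sum of nonnegative edge energies, so its vanishing forces equality
across every edge and then along walks. -/
theorem eq_of_inner_lapCLM_self_eq_zero (hG : G.Connected) (hw : ∀ i j, w i j = w j i)
    (hp : ∀ i j, G.Adj i j → 0 < w i j) {y : Prof N k} (h : inner ℝ (lapCLM G w k y) y = 0)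
    (i j : Fin N) : y i = y j := by
  have hnn : ∀ i j, 0 ≤ adjWeight G w i j * inner ℝ (y i - y j) (y i - y j) := fun i j => by
    refine mul_nonneg ?_ real_inner_self_nonneg
    rw [adjWeight]; split_ifs with h
    exacts [(hp i j h).le, le_rfl]
  have hadj : ∀ i j, G.Adj i j → y i = y j := by
    intro i j hij
    rw [inner_lapCLM G w hw] at h
    have h1 : ∑ i, ∑ j, adjWeight G w i j * inner ℝ (y i - y j) (y i - y j) = 0 := by linarith
    have h2 := (Finset.sum_eq_zero_iff_of_nonneg fun i _ => Finset.sum_nonneg fun j _ => hnn i j).1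
      h1 i (Finset.mem_univ i)
    have h3 := (Finset.sum_eq_zero_iff_of_nonneg fun j _ => hnn i j).1 h2 j (Finset.mem_univ j)
    have h4 : adjWeight G w i j ≠ 0 := by simp [adjWeight, hij, (hp i j hij).ne']
    exact sub_eq_zero.1 (inner_self_eq_zero.1 ((mul_eq_zero.1 h3).resolve_left h4))
  obtain ⟨p⟩ := hG.preconnected i j
  induction p with
  | nil => rfl
  | cons hij _ ih => exact (hadj _ _ hij).trans ih

theorem eq_zero_of_inner_lapCLM_self_eq_zero (hG : G.Connected) (hw : ∀ i j, w i j = w j i)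
    (hp : ∀ i j, G.Adj i j → 0 < w i j) {y : Prof N k} (h : inner ℝ (lapCLM G w k y) y = 0)
    (hs : ∑ i, y i = 0) : y = 0 := by
  ext i : 1
  have hN : (N : ℝ) ≠ 0 := by have := i.pos; positivity
  have h1 : ∑ j, y j = (N : ℝ) • y i := by
    rw [Finset.sum_congr rfl fun j _ => eq_of_inner_lapCLM_self_eq_zero hG hw hp h j i]
    simp [← Nat.cast_smul_eq_nsmul ℝ]
  rw [hs] at h1
  exact (smul_eq_zero.1 h1.symm).resolve_left hN

/-- The form is continuous and positive on the compact unit sphere of the zero-sum subspace;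
homogeneity extends its minimum there to the whole subspace. -/
theorem exists_spectral_gap (hG : G.Connected) (hw : ∀ i j, w i j = w j i)
    (hp : ∀ i j, G.Adj i j → 0 < w i j) (k : ℕ) :
    ∃ c : ℝ, 0 < c ∧ ∀ y : Prof N k, ∑ i, y i = 0 →
      c * ‖y‖ ^ 2 ≤ inner ℝ (lapCLM G w k y) y := by
  set K : Set (Prof N k) := {y | ∑ i, y i = 0} ∩ Metric.sphere 0 1 with hK
  have hcomp : IsCompact K :=
    (isCompact_sphere 0 1).inter_left (isClosed_eq (by fun_prop) continuous_const)
  have hscale : ∀ c : ℝ, (∀ y ∈ K, c ≤ inner ℝ (lapCLM G w k y) y) →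
      ∀ y : Prof N k, ∑ i, y i = 0 → c * ‖y‖ ^ 2 ≤ inner ℝ (lapCLM G w k y) y := by
    intro c hc y hy
    rcases eq_or_ne y 0 with rfl | hne
    · simp
    have hy0 : 0 < ‖y‖ := norm_pos_iff.2 hne
    have hmem : ‖y‖⁻¹ • y ∈ K := by
      refine ⟨?_, ?_⟩
      · simp [← Finset.smul_sum, hy]
      · simp [norm_smul, hy0.ne']
    have := hc _ hmem
    rw [map_smul, real_inner_smul_left, real_inner_smul_right, ← mul_assoc, ← sq, inv_pow,
      inv_mul_eq_div, le_div_iff₀ (by positivity)] at this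
    exact this
  -- The sphere is empty when the zero-sum subspace is trivial, for example with a single agent; any
  -- constant then works.
  rcases K.eq_empty_or_nonempty with he | hne
  · exact ⟨1, one_pos, hscale 1 fun y hy => by simp [he] at hy⟩
  · obtain ⟨y₀, hy₀, hmin⟩ := hcomp.exists_isMinOn hne
      (f := fun y => inner ℝ (lapCLM G w k y) y) (by fun_prop)
    refine ⟨inner ℝ (lapCLM G w k y₀) y₀, ?_, hscale _ fun y hy => hmin hy⟩
    refine (inner_lapCLM_self_nonneg hw hp y₀).lt_of_ne fun h => ?_
    have := eq_zero_of_inner_lapCLM_self_eq_zero hG hw hp h.symm hy₀.1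
    have h1 := hy₀.2
    simp [this] at h1

/-- The squared norm is multiplied by at most `1 - 2 γ c + γ² C`, which is smallest at `γ = c / C`.
The `+ 1` in `C` keeps the quotient meaningful when the Laplacian vanishes. -/
theorem exists_gossip_contraction (hG : G.Connected) (hw : ∀ i j, w i j = w j i)
    (hp : ∀ i j, G.Adj i j → 0 < w i j) (k : ℕ) :
    ∃ γ θ : ℝ, 0 < γ ∧ 0 ≤ θ ∧ θ < 1 ∧ ∀ y : Prof N k, ∑ i, y i = 0 →
      ‖y - γ • lapCLM G w k y‖ ≤ θ * ‖y‖ := by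
  obtain ⟨c, hc, hgap⟩ := exists_spectral_gap hG hw hp k
  set C := ‖lapCLM G w k‖ ^ 2 + 1 with hC
  have hC0 : 0 < C := by positivity
  refine ⟨c / C, Real.sqrt (1 - c ^ 2 / C), by positivity, Real.sqrt_nonneg _, ?_, fun y hy => ?_⟩
  · rw [Real.sqrt_lt' one_pos]
    have : 0 < c ^ 2 / C := by positivity
    linarith
  · rw [← Real.sqrt_sq (norm_nonneg y), ← Real.sqrt_mul' _ (sq_nonneg _)]
    refine Real.le_sqrt_of_sq_le ?_
    rw [norm_sub_sq_real, inner_smul_right, norm_smul, mul_pow, Real.norm_eq_abs, sq_abs,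
      real_inner_comm]
    have h1 := hgap y hy
    have h2 : ‖lapCLM G w k y‖ ^ 2 ≤ C * ‖y‖ ^ 2 := by
      have := pow_le_pow_left₀ (norm_nonneg _) ((lapCLM G w k).le_opNorm y) 2
      rw [mul_pow] at this
      nlinarith [sq_nonneg ‖y‖]
    have h3 := mul_le_mul_of_nonneg_left h1 (by positivity : 0 ≤ c / C)
    have h4 := mul_le_mul_of_nonneg_left h2 (sq_nonneg (c / C))
    have h5 : (1 - c ^ 2 / C) * ‖y‖ ^ 2
        = ‖y‖ ^ 2 - 2 * (c / C * (c * ‖y‖ ^ 2)) + (c / C) ^ 2 * (C * ‖y‖ ^ 2) := by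
      field_simp; ring
    linarith

/-- The Laplacian maps the finite-dimensional zero-sum subspace to itself injectively, hence onto.
-/
theorem exists_lapCLM_eq (hG : G.Connected) (hw : ∀ i j, w i j = w j i)
    (hp : ∀ i j, G.Adj i j → 0 < w i j) {y : Prof N k} (hy : ∑ i, y i = 0) :
    ∃ z, lapCLM G w k z = y := by
  let W : Submodule ℝ (Prof N k) :=
    { carrier := {y | ∑ i, y i = 0}
      add_mem' := fun {a b} ha hb => by
        simp only [Set.mem_ofPred_eq, PiLp.add_apply, Finset.sum_add_distrib] at *
        simp [ha, hb]
      zero_mem' := by simp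
      smul_mem' := fun c a ha => by
        simp only [Set.mem_ofPred_eq, PiLp.smul_apply, ← Finset.smul_sum] at *
        simp [ha] }
  let T : W →ₗ[ℝ] W := (lapCLM G w k).toLinearMap.restrict fun y _ => sum_lapCLM G w hw y
  have hinj : Function.Injective T := by
    rw [injective_iff_map_eq_zero]
    intro z hz
    have h1 : lapCLM G w k z = 0 := congrArg Subtype.val hz
    exact Subtype.ext (eq_zero_of_inner_lapCLM_self_eq_zero hG hw hp (by rw [h1, inner_zero_left])
      z.2)
  obtain ⟨z, hz⟩ := LinearMap.injective_iff_surjective.1 hinj ⟨y, hy⟩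
  exact ⟨z, congrArg Subtype.val hz⟩

end Laplacian

/-- Convexity is available only on `S`, so the derivative at `x` is compared with one-sided slopes
on the segment to `y`. -/
theorem ConvexOn.add_inner_le_of_hasGradientAt {E : Type*} [NormedAddCommGroup E]
    [InnerProductSpace ℝ E] [CompleteSpace E] {S : Set E} {f : E → ℝ} (hf : ConvexOn ℝ S f)
    {x y d : E} (hd : HasGradientAt f d x) (hx : x ∈ S) (hy : y ∈ S) :
    f x + inner ℝ d (y - x) ≤ f y := by
  have h1 : HasDerivAt (fun t : ℝ => f (x + t • (y - x))) (inner ℝ d (y - x)) 0 := by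
    have h2 : HasDerivAt (fun t : ℝ => x + t • (y - x)) (y - x) 0 := by
      simpa using ((hasDerivAt_id (0 : ℝ)).smul_const (y - x)).const_add x
    have h3 : HasFDerivAt f (InnerProductSpace.toDual ℝ E d) (x + (0 : ℝ) • (y - x)) := by
      simpa using hd.hasFDerivAt
    exact (h3.comp_hasDerivAt (0 : ℝ) h2).congr_deriv (by simp)
  have h4 := (hasDerivAt_iff_tendsto_slope.1 h1).mono_left
    (nhdsWithin_mono 0 (fun t (ht : 0 < t) => ht.ne') : 𝓝[>] (0 : ℝ) ≤ 𝓝[≠] 0)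
  have h5 : inner ℝ d (y - x) ≤ f y - f x := by
    refine le_of_tendsto h4 ?_
    filter_upwards [Ioo_mem_nhdsGT (zero_lt_one' ℝ)] with t ht
    have h6 := hf.2 hx hy (by linarith [ht.2] : 0 ≤ 1 - t) ht.1.le (by ring)
    have e : (1 - t) • x + t • y = x + t • (y - x) := by module
    rw [e] at h6
    simp only [smul_eq_mul] at h6
    rw [slope_def_field, sub_zero, div_le_iff₀ ht.1]
    simp only [zero_smul, add_zero]
    linarith
  linarith

theorem sum_apply_update {ι X M : Type*} [Fintype ι] [DecidableEq ι] [AddCommGroup M]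
    (φ : ι → X → M) (x : ι → X) (i : ι) (t : X) :
    ∑ j, φ j (Function.update x i t j) = ∑ j, φ j (x j) + (φ i t - φ i (x i)) := by
  rw [← sub_eq_iff_eq_add', ← Finset.sum_sub_distrib, Finset.sum_eq_single i]
  · simp
  · intro j _ hj
    simp [hj]
  · simp

theorem avg_update {N n : ℕ} (x : Fin N → Vec n) (i : Fin N) (t : Vec n) :
    avg (Function.update x i t) = avg x + (1 / (N : ℝ)) • (t - x i) := by
  rw [avg, avg, ← smul_add, sum_apply_update (fun _ v => v)]

/-! ### Gradients, KKT points and equilibria of the game. -/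

namespace AggregativeGame

variable {N n m : ℕ} {Ξ : Fin N → Type*} [∀ i, MeasurableSpace (Ξ i)]
  {𝒢 : AggregativeGame N n m Ξ}

/-- The chain rule along `t ↦ (t, avg (update x i t))`, whose second component has derivative `1 /
N`. Consequently `pseudograd` sees the other agents only through the average. -/
theorem Assumptions.hasGradientAt (h : 𝒢.Assumptions) (x : Fin N → Vec n) (i : Fin N) (ξ : Ξ i) :
    HasGradientAt (fun t => 𝒢.f i t (avg (Function.update x i t)) ξ)
      (𝒢.sampleGrad i (x i) (avg x) ξ) (x i) := by
  have hD := (h.f_differentiable i ξ (x i, avg x)).hasFDerivAt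
  set D := fderiv ℝ (fun p : Vec n × Vec n => 𝒢.f i p.1 p.2 ξ) (x i, avg x) with hDdef
  have h1 : HasFDerivAt (fun t => 𝒢.f i t (avg x) ξ)
      (D.comp (ContinuousLinearMap.inl ℝ (Vec n) (Vec n))) (x i) :=
    HasFDerivAt.comp (g := fun p : Vec n × Vec n => 𝒢.f i p.1 p.2 ξ) (f := fun e => (e, avg x))
      (x i) hD (hasFDerivAt_prodMk_left (x i) (avg x))
  have h2 : HasFDerivAt (fun t => 𝒢.f i (x i) t ξ)
      (D.comp (ContinuousLinearMap.inr ℝ (Vec n) (Vec n))) (avg x) :=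
    HasFDerivAt.comp (g := fun p : Vec n × Vec n => 𝒢.f i p.1 p.2 ξ) (avg x) hD
      (hasFDerivAt_prodMk_right (x i) (avg x))
  have h3 : HasFDerivAt (fun t => (t, avg (Function.update x i t)))
      ((ContinuousLinearMap.id ℝ (Vec n)).prod
        ((1 / (N : ℝ)) • ContinuousLinearMap.id ℝ (Vec n))) (x i) := by
    refine (hasFDerivAt_id (x i)).prodMk ?_
    simp only [avg_update]
    exact (((hasFDerivAt_id (x i)).sub_const (x i)).const_smul (1 / (N : ℝ))).const_add (avg x)
  have hD' : HasFDerivAt (fun p : Vec n × Vec n => 𝒢.f i p.1 p.2 ξ) D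
      (x i, avg (Function.update x i (x i))) := by
    rw [Function.update_eq_self]; exact hD
  have h4 := HasFDerivAt.comp (g := fun p : Vec n × Vec n => 𝒢.f i p.1 p.2 ξ) (x i) hD' h3
  rw [hasGradientAt_iff_hasFDerivAt]
  refine h4.congr_fderiv ?_
  ext v
  simp only [sampleGrad, gradient, h1.fderiv, h2.fderiv, map_add, map_smul,
    LinearIsometryEquiv.apply_symm_apply]
  simp only [add_apply, smul_apply,
    ContinuousLinearMap.comp_apply, ContinuousLinearMap.prod_apply, ContinuousLinearMap.id_apply,
    ContinuousLinearMap.inl_apply, ContinuousLinearMap.inr_apply]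
  rw [← map_smul, ← map_add]
  simp

theorem Assumptions.pseudograd_eq (h : 𝒢.Assumptions) (x : Fin N → Vec n) (i : Fin N) :
    𝒢.pseudograd x i = 𝒢.extPseudograd i (x i) (avg x) := by
  simp only [pseudograd, extPseudograd, (h.hasGradientAt x i _).gradient]

/-- The pseudogradient on the Euclidean space of profiles. -/
noncomputable def profGrad (𝒢 : AggregativeGame N n m Ξ) (x : Prof N n) : Prof N n :=
  WithLp.toLp 2 (𝒢.pseudograd x)

/-- The extended pseudogradient on the Euclidean space of profiles. -/
noncomputable def profExtGrad (𝒢 : AggregativeGame N n m Ξ) (x u : Prof N n) : Prof N n :=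
  WithLp.toLp 2 (fun i => 𝒢.extPseudograd i (x i) (u i))

/-- The local constraint set in the Euclidean space of profiles. -/
def profDomain (𝒢 : AggregativeGame N n m Ξ) : Set (Prof N n) := {x | ∀ i, x i ∈ 𝒢.Ω i}

theorem Assumptions.profGrad_lipschitz (h : 𝒢.Assumptions) :
    ∃ l : ℝ, 0 < l ∧ ∀ x y, ‖𝒢.profGrad x - 𝒢.profGrad y‖ ^ 2 ≤ l ^ 2 * ‖x - y‖ ^ 2 := by
  obtain ⟨l, hl, hlip⟩ := h.lipschitz
  refine ⟨l, hl, fun x y => ?_⟩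
  rw [PiLp.norm_sq_eq_of_L2, PiLp.norm_sq_eq_of_L2]
  exact hlip x y

theorem Assumptions.profGrad_monotone (h : 𝒢.Assumptions) :
    ∃ η : ℝ, 0 < η ∧ ∀ x ∈ 𝒢.profDomain, ∀ y ∈ 𝒢.profDomain,
      η * ‖x - y‖ ^ 2 ≤ inner ℝ (𝒢.profGrad x - 𝒢.profGrad y) (x - y) := by
  obtain ⟨η, hη, hmono⟩ := h.strongly_monotone
  refine ⟨η, hη, fun x hx y hy => ?_⟩
  rw [PiLp.norm_sq_eq_of_L2, PiLp.inner_apply]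
  exact hmono x y hx hy

theorem Assumptions.isCompact_profDomain (h : 𝒢.Assumptions) : IsCompact 𝒢.profDomain := by
  have : 𝒢.profDomain = WithLp.toLp 2 '' (Set.univ.pi 𝒢.Ω) := by
    ext x
    constructor
    · intro hx
      exact ⟨x.ofLp, fun i _ => hx i, rfl⟩
    · rintro ⟨y, hy, rfl⟩ i
      exact hy i trivial
  rw [this]
  exact (isCompact_univ_pi h.isCompact).image (PiLp.continuous_toLp 2 _)

theorem Assumptions.convex_profDomain (h : 𝒢.Assumptions) : Convex ℝ 𝒢.profDomain :=
  fun _ hx _ hy _ _ ha hb hab i => h.convex i (hx i) (hy i) ha hb hab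

/-- The sum of the nonsmooth costs. -/
def totalCost (𝒢 : AggregativeGame N n m Ξ) (x : Prof N n) : ℝ := ∑ i, 𝒢.g i (x i)

theorem Assumptions.convexOn_totalCost (h : 𝒢.Assumptions) :
    ConvexOn ℝ 𝒢.profDomain 𝒢.totalCost := by
  refine ⟨h.convex_profDomain, fun x hx y hy a b ha hb hab => ?_⟩
  simp only [totalCost, smul_eq_mul, Finset.mul_sum, ← Finset.sum_add_distrib]
  exact Finset.sum_le_sum fun i _ => (h.g_convex i).2 (hx i) (hy i) ha hb hab

theorem Assumptions.lowerSemicontinuousOn_totalCost (h : 𝒢.Assumptions) :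
    LowerSemicontinuousOn 𝒢.totalCost 𝒢.profDomain := by
  refine lowerSemicontinuousOn_sum fun i _ x hx a ha => ?_
  have ht : Tendsto (fun y : Prof N n => y i) (𝓝[𝒢.profDomain] x) (𝓝[𝒢.Ω i] (x i)) :=
    tendsto_nhdsWithin_iff.2
      ⟨((show Continuous fun y : Prof N n => y i by fun_prop).tendsto x).mono_left
        nhdsWithin_le_nhds, eventually_nhdsWithin_of_forall fun y hy => hy i⟩
  exact ht.eventually (h.g_lsc i (x i) (hx i) a ha)

/-- The collective feasible set in the Euclidean space of profiles. -/
def profFeasible (𝒢 : AggregativeGame N n m Ξ) : Set (Prof N n) := {x | x.ofLp ∈ 𝒢.feasible}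

theorem Assumptions.isCompact_profFeasible (h : 𝒢.Assumptions) : IsCompact 𝒢.profFeasible := by
  have : 𝒢.profFeasible = 𝒢.profDomain ∩
      ⋂ r, {x : Prof N n | (∑ i, 𝒢.A i (x i)) r ≤ (∑ i, 𝒢.b i) r} := by
    ext x; simp [profFeasible, feasible, profDomain]
  rw [this]
  exact h.isCompact_profDomain.inter_right
    (isClosed_iInter fun r => isClosed_le (by fun_prop) continuous_const)

/-- The excess in the coupling constraints. -/
noncomputable def excess (𝒢 : AggregativeGame N n m Ξ) (x : Fin N → Vec n) : Vec m :=
  ∑ i, 𝒢.A i (x i) - ∑ i, 𝒢.b i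

theorem excess_combo (x y : Fin N → Vec n) {a b : ℝ} (hab : a + b = 1) :
    𝒢.excess (a • x + b • y) = a • 𝒢.excess x + b • 𝒢.excess y := by
  obtain rfl : b = 1 - a := by linarith
  simp only [excess, Pi.add_apply, Pi.smul_apply, map_add, map_smul, Finset.sum_add_distrib,
    ← Finset.smul_sum]
  module

theorem mem_feasible_iff {x : Fin N → Vec n} :
    x ∈ 𝒢.feasible ↔ (∀ i, x i ∈ 𝒢.Ω i) ∧ ∀ r, 𝒢.excess x r ≤ 0 := by
  simp [feasible, excess]

theorem convexOn_excess (h : 𝒢.Assumptions) (r : Fin m) :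
    ConvexOn ℝ 𝒢.profDomain (fun x => 𝒢.excess x r) := by
  refine ⟨h.convex_profDomain, fun x _ y _ a b _ _ hab => ?_⟩
  have : 𝒢.excess (a • x + b • y : Prof N n) = a • 𝒢.excess x + b • 𝒢.excess y :=
    excess_combo x.ofLp y.ofLp hab
  simp only [this]
  simp

theorem Assumptions.convex_profFeasible (h : 𝒢.Assumptions) : Convex ℝ 𝒢.profFeasible := by
  intro x hx y hy a b ha hb hab
  have hx' := mem_feasible_iff.1 hx
  have hy' := mem_feasible_iff.1 hy
  refine mem_feasible_iff.2 ⟨h.convex_profDomain hx'.1 hy'.1 ha hb hab, fun r => ?_⟩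
  refine ((convexOn_excess h r).2 hx'.1 hy'.1 ha hb hab).trans ?_
  simp only [smul_eq_mul]
  nlinarith [hx'.2 r, hy'.2 r]

/-- Karush–Kuhn–Tucker conditions with a common multiplier of the coupling constraints. -/
structure IsKKT (𝒢 : AggregativeGame N n m Ξ) (x : Fin N → Vec n) (lam : Vec m) : Prop where
  feasible : x ∈ 𝒢.feasible
  nonneg : ∀ r, 0 ≤ lam r
  slackness : inner ℝ lam (𝒢.excess x) = 0
  stationary : ∀ i, -(𝒢.pseudograd x i + (𝒢.A i).adjoint lam) ∈ 𝒢.subdiff i (x i)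

/-- The solution `x` of the variational inequality over the feasible set minimizes there the convex
function `totalCost y + ⟪F x, y - x⟫` with frozen gradient. Its Lagrangian inequality, tested at
profiles that differ from `x` in one block, splits into the agents' stationarity conditions with one
shared multiplier. -/
theorem Assumptions.exists_isKKT (h : 𝒢.Assumptions) : ∃ x lam, 𝒢.IsKKT x lam := by
  obtain ⟨η, hη, hmono⟩ := h.profGrad_monotone
  obtain ⟨l, hl, hlip⟩ := h.profGrad_lipschitz
  obtain ⟨xs, hxs, hslat⟩ := h.slater
  have hslat' : ∀ r, 𝒢.excess xs r < 0 := fun r => by simpa [excess] using hslat r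
  have hsub : 𝒢.profFeasible ⊆ 𝒢.profDomain := fun x hx => hx.1
  obtain ⟨x, hx, hmin⟩ := exists_mixed_variational_inequality h.isCompact_profFeasible
    ⟨WithLp.toLp 2 xs, mem_feasible_iff.2 ⟨hxs, fun r => (hslat' r).le⟩⟩
    (h.lowerSemicontinuousOn_totalCost.mono hsub)
    (h.convexOn_totalCost.subset hsub h.convex_profFeasible) hη hl
    (fun x hx y hy => hmono x (hsub hx) y (hsub hy)) hlip
  have hx' := mem_feasible_iff.1 hx
  have hφ : ConvexOn ℝ 𝒢.profDomain
      (fun y => 𝒢.totalCost y + inner ℝ (𝒢.profGrad x) (y - x)) := by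
    refine h.convexOn_totalCost.add ⟨h.convex_profDomain, fun y _ z _ a b _ _ hab => ?_⟩
    obtain rfl : b = 1 - a := by linarith
    have e : a • y + (1 - a) • z - x = a • (y - x) + (1 - a) • (z - x) := by module
    simp only [e, inner_add_right, real_inner_smul_right, smul_eq_mul, le_refl]
  obtain ⟨lam, hlam, hcs, hlag⟩ := exists_lagrange_multiplier hφ (convexOn_excess h)
    hx'.1 hx'.2
    (fun y hy hc => by simpa using hmin y (mem_feasible_iff.2 ⟨hy, hc⟩))
    ⟨WithLp.toLp 2 xs, hxs, hslat'⟩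
  have hinner : ∀ v : Vec m, inner ℝ (WithLp.toLp 2 lam : Vec m) v = ∑ r, lam r * v r := by
    intro v
    simp [PiLp.inner_apply, mul_comm]
  refine ⟨x, WithLp.toLp 2 lam, hx, hlam, by rw [hinner, hcs], fun i => ⟨hx'.1 i, fun y hy => ?_⟩⟩
  have hmem : (WithLp.toLp 2 (Function.update x.ofLp i y) : Prof N n) ∈ 𝒢.profDomain := by
    intro j
    rcases eq_or_ne j i with rfl | hj
    · simpa using hy
    · simpa [hj] using hx'.1 j
  have h1 := hlag _ hmem
  have h2 : 𝒢.totalCost (WithLp.toLp 2 (Function.update x.ofLp i y))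
      = 𝒢.totalCost x + (𝒢.g i y - 𝒢.g i (x i)) := sum_apply_update 𝒢.g x.ofLp i y
  have h3 : inner ℝ (𝒢.profGrad x) (WithLp.toLp 2 (Function.update x.ofLp i y) - x)
      = inner ℝ (𝒢.pseudograd x i) (y - x i) := by
    rw [PiLp.inner_apply, Finset.sum_eq_single i]
    · simp [profGrad]
    · intro j _ hj
      simp [hj]
    · simp
  have h4 : 𝒢.excess (Function.update x.ofLp i y) = 𝒢.excess x + 𝒢.A i (y - x i) := by
    rw [excess, excess, sum_apply_update (fun j v => 𝒢.A j v), map_sub]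
    abel
  have h5 : ∑ r, lam r * 𝒢.excess (Function.update x.ofLp i y) r
      = inner ℝ ((𝒢.A i).adjoint (WithLp.toLp 2 lam)) (y - x i) := by
    rw [← hinner, h4, inner_add_right, hinner, hcs, zero_add,
      ContinuousLinearMap.adjoint_inner_left]
  rw [h2, h3, h5] at h1
  simp only [sub_self, inner_zero_right] at h1
  rw [inner_neg_left, inner_add_left]
  linarith

/-- The adjoint terms telescope to `⟪lam, excess x⟫ - ⟪lam, excess y⟫`: the first vanishes by
slackness and the second is nonpositive for feasible `y`. -/
theorem IsKKT.solvesSVI {x : Fin N → Vec n} {lam : Vec m} (hk : 𝒢.IsKKT x lam) :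
    𝒢.SolvesSVI x := by
  refine ⟨hk.feasible, _, hk.stationary, fun y hy => ?_⟩
  have h1 : ∑ i, inner ℝ (𝒢.pseudograd x i + -(𝒢.pseudograd x i + (𝒢.A i).adjoint lam)) (y i - x i)
      = inner ℝ lam (𝒢.excess x) - inner ℝ lam (𝒢.excess y) := by
    have : ∀ i, 𝒢.pseudograd x i + -(𝒢.pseudograd x i + (𝒢.A i).adjoint lam)
        = -(𝒢.A i).adjoint lam := fun i => by abel
    simp only [this, inner_neg_left, ContinuousLinearMap.adjoint_inner_left, Finset.sum_neg_distrib,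
      ← inner_sum, Finset.sum_sub_distrib, excess, inner_sub_right]
    ring
  rw [h1, hk.slackness, zero_sub, neg_nonneg, PiLp.inner_apply]
  refine Finset.sum_nonpos fun r _ => ?_
  simp only [RCLike.inner_apply, conj_trivial]
  exact mul_nonpos_of_nonpos_of_nonneg ((mem_feasible_iff.1 hy).2 r) (hk.nonneg r)

/-- A unilateral feasible deviation is a feasible profile because the constraints are shared. The
variational inequality at that profile combines with the subgradient inequality of `g i` and the
integrated gradient inequality of `f i`. -/
theorem Assumptions.isSGNE_of_solvesSVI (h : 𝒢.Assumptions) {x : Fin N → Vec n}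
    (hx : 𝒢.SolvesSVI x) : 𝒢.IsSGNE x := by
  obtain ⟨hfeas, v, hv, hvi⟩ := hx
  refine ⟨hfeas, fun i t ht => ?_⟩
  have := h.isProbabilityMeasure
  have hupΩ : ∀ j, Function.update x i t j ∈ 𝒢.Ω j := by
    intro j
    rcases eq_or_ne j i with rfl | hj
    · simpa using ht.1
    · simpa [hj] using hfeas.1 j
  have hup : Function.update x i t ∈ 𝒢.feasible := by
    refine ⟨hupΩ, fun r => ?_⟩
    have h1 := ht.2 r
    rw [sum_apply_update (fun j v => 𝒢.A j v),
      ← Finset.add_sum_erase _ (fun j => 𝒢.A j (x j)) (Finset.mem_univ i)]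
    simp only [PiLp.add_apply, PiLp.sub_apply] at h1 ⊢
    linarith
  have h1 := hvi _ hup
  rw [Finset.sum_eq_single i (fun j _ hj => by simp [hj]) (by simp), Function.update_self,
    inner_add_left] at h1
  have h2 := (hv i).2 t ht.1
  have hint := h.grad_integrable i (x i) (avg x)
  have h3 : ∀ ξ : ∀ j, Ξ j, 𝒢.f i (x i) (avg x) (ξ i)
      + inner ℝ (𝒢.sampleGrad i (x i) (avg x) (ξ i)) (t - x i)
      ≤ 𝒢.f i t (avg (Function.update x i t)) (ξ i) := by
    intro ξ
    have := (h.f_convex x hfeas i (ξ i)).add_inner_le_of_hasGradientAt (h.hasGradientAt x i (ξ i))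
      (hfeas.1 i) ht.1
    simpa using this
  have hI1 := h.f_integrable x hfeas.1 i
  have hI2 := h.f_integrable _ hupΩ i
  have hI3 : Integrable (fun ξ => inner ℝ (𝒢.sampleGrad i (x i) (avg x) (ξ i)) (t - x i)) 𝒢.P :=
    hint.inner_const _
  simp only [Function.update_self] at hI2
  have h4 := integral_mono (hI1.add hI3) hI2 h3
  have h5 : ∫ ξ, inner ℝ (𝒢.sampleGrad i (x i) (avg x) (ξ i)) (t - x i) ∂𝒢.P
      = inner ℝ (𝒢.pseudograd x i) (t - x i) := by
    rw [h.pseudograd_eq, extPseudograd, real_inner_comm, ← integral_inner hint]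
    simp only [real_inner_comm]
  simp only [Pi.add_apply] at h4
  rw [integral_add hI1 hI3, h5] at h4
  simp only [cost, Function.update_self]
  linarith

/-- Each solution is tested against the other; monotonicity of the subdifferentials and strong
monotonicity of the pseudogradient leave only distance zero. -/
theorem Assumptions.solvesSVI_unique (h : 𝒢.Assumptions) {x y : Fin N → Vec n}
    (hx : 𝒢.SolvesSVI x) (hy : 𝒢.SolvesSVI y) : y = x := by
  obtain ⟨η, hη, hmono⟩ := h.strongly_monotone
  obtain ⟨hxf, v, hv, hxv⟩ := hx
  obtain ⟨hyf, v', hv', hyv⟩ := hy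
  have h1 := hxv y hyf
  have h2 := hyv x hxf
  have h3 := hmono x y hxf.1 hyf.1
  have h4 : ∑ i, inner ℝ (v i - v' i) (y i - x i) ≤ 0 := by
    refine Finset.sum_nonpos fun i _ => ?_
    have h5 := (hv i).2 (y i) (hyf.1 i)
    have h6 := (hv' i).2 (x i) (hxf.1 i)
    rw [← neg_sub (y i) (x i), inner_neg_right] at h6
    rw [inner_sub_left]
    linarith
  have h5 : ∑ i, inner ℝ (𝒢.pseudograd x i + v i) (y i - x i)
      + ∑ i, inner ℝ (𝒢.pseudograd y i + v' i) (x i - y i)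
      = ∑ i, inner ℝ (v i - v' i) (y i - x i)
        - ∑ i, inner ℝ (𝒢.pseudograd x i - 𝒢.pseudograd y i) (x i - y i) := by
    simp only [← Finset.sum_add_distrib, ← Finset.sum_sub_distrib]
    refine Finset.sum_congr rfl fun i _ => ?_
    rw [← neg_sub (y i) (x i)]
    simp only [inner_neg_right, inner_sub_left, inner_add_left]
    ring
  have h6 : ∑ i, ‖x i - y i‖ ^ 2 ≤ 0 := by
    by_contra! hpos
    nlinarith [mul_pos hη hpos]
  have h7 := (Finset.sum_eq_zero_iff_of_nonneg fun i _ => sq_nonneg ‖x i - y i‖).1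
    (le_antisymm h6 (Finset.sum_nonneg fun i _ => sq_nonneg _))
  funext i
  have := h7 i (Finset.mem_univ i)
  exact (sub_eq_zero.1 (norm_eq_zero.1 (pow_eq_zero_iff two_ne_zero |>.1 this))).symm

/-- Only the total constraint excess satisfies complementarity with the multiplier. The zero-sum
deviations of the local residuals lie in the range of the Laplacian, so some `z` redistributes them
until every agent carries the share `excess / N`. -/
theorem IsKKT.exists_dual_consensus (hN : 0 < N) {x : Fin N → Vec n} {lam : Vec m}
    (hk : 𝒢.IsKKT x lam) {G : SimpleGraph (Fin N)} [DecidableRel G.Adj] (hG : G.Connected)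
    {w : Fin N → Fin N → ℝ} (hw : ∀ i j, w i j = w j i) (hp : ∀ i j, G.Adj i j → 0 < w i j) :
    ∃ z : Prof N m, ∀ μ : Vec m, (∀ r, 0 ≤ μ r) → ∀ i,
      inner ℝ (𝒢.A i (x i) - 𝒢.b i - lapCLM G w m z i) (μ - lam) ≤ 0 := by
  have hN' : (N : ℝ) ≠ 0 := by positivity
  set y : Prof N m := WithLp.toLp 2
    (fun i => 𝒢.A i (x i) - 𝒢.b i - (1 / (N : ℝ)) • 𝒢.excess x) with hy
  have hy0 : ∑ i, y i = 0 := by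
    simp only [hy, Finset.sum_sub_distrib]
    simp [← Nat.cast_smul_eq_nsmul ℝ, smul_smul, hN', excess]
  obtain ⟨z, hz⟩ := exists_lapCLM_eq hG hw hp hy0
  refine ⟨z, fun μ hμ i => ?_⟩
  have e : 𝒢.A i (x i) - 𝒢.b i - lapCLM G w m z i = (1 / (N : ℝ)) • 𝒢.excess x := by
    rw [hz, hy]; simp
  rw [e, real_inner_smul_left, inner_sub_right, real_inner_comm lam, hk.slackness, sub_zero]
  refine mul_nonpos_of_nonneg_of_nonpos (by positivity) ?_
  rw [PiLp.inner_apply]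
  refine Finset.sum_nonpos fun r _ => ?_
  simp only [RCLike.inner_apply, conj_trivial]
  exact mul_nonpos_of_nonneg_of_nonpos (hμ r) ((mem_feasible_iff.1 hk.feasible).2 r)

/-- Only `pseudograd` is assumed Lipschitz, so the dependence of the extended map on the estimate `u
i` is realized by an actual profile: keep block `i` and shift all the others equally until the
average equals `u i`. -/
theorem Assumptions.profExtGrad_lipschitz (h : 𝒢.Assumptions) (hN : 0 < N) :
    ∃ l : ℝ, 0 < l ∧ ∀ x u : Prof N n, avg u = avg x →
      ‖𝒢.profExtGrad x u - 𝒢.profGrad x‖ ≤ l * ‖u - meanCLM N n u‖ := by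
  obtain ⟨l, hl, hlip⟩ := h.lipschitz
  have hN' : (0 : ℝ) < N := by positivity
  refine ⟨l * N, by positivity, fun x u hu => ?_⟩
  have key : ∀ i, ‖𝒢.extPseudograd i (x i) (u i) - 𝒢.pseudograd x i‖ ^ 2
      ≤ (l * N) ^ 2 * ‖u i - avg u‖ ^ 2 := by
    intro i
    -- A single agent has no other block to shift, but its estimate is the average.
    obtain rfl | hN2 : N = 1 ∨ 2 ≤ N := by omega
    · have e : ∀ y : Fin 1 → Vec n, avg y = y i := fun y => by
        simp [avg, Subsingleton.elim i 0]
      rw [h.pseudograd_eq, ← hu, e u, sub_self, sub_self]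
      simp
    · have hN1 : (1 : ℝ) ≤ (N : ℝ) - 1 := by
        have : (2 : ℝ) ≤ N := by exact_mod_cast hN2
        linarith
      set d := u i - avg u with hd
      set X : Fin N → Vec n := fun j => x j + if j = i then 0 else ((N : ℝ) / (N - 1)) • d with hX
      have hXi : X i = x i := by simp [hX]
      have hsum : ∑ j : Fin N, (if j = i then (0 : Vec n) else ((N : ℝ) / (N - 1)) • d)
          = (N : ℝ) • d := by
        rw [Finset.sum_ite, Finset.sum_const_zero, zero_add, Finset.sum_const, Finset.filter_ne',
          Finset.card_erase_of_mem (Finset.mem_univ i), Finset.card_univ, Fintype.card_fin,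
          ← Nat.cast_smul_eq_nsmul ℝ, Nat.cast_sub (by omega), smul_smul]
        congr 1
        have : (N : ℝ) - 1 ≠ 0 := by linarith
        push_cast
        field_simp
      have hXavg : avg X = u i := by
        rw [hX, avg, Finset.sum_add_distrib, hsum, smul_add, smul_smul, one_div_mul_cancel hN'.ne',
          one_smul, ← avg, ← hu, hd]
        abel
      have h1 := hlip X x
      have h2 : ‖𝒢.pseudograd X i - 𝒢.pseudograd x i‖ ^ 2
          ≤ ∑ j, ‖𝒢.pseudograd X j - 𝒢.pseudograd x j‖ ^ 2 :=
        Finset.single_le_sum (f := fun j => ‖𝒢.pseudograd X j - 𝒢.pseudograd x j‖ ^ 2)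
          (fun j _ => sq_nonneg _) (Finset.mem_univ i)
      have h3 : ∑ j, ‖X j - x j‖ ^ 2 ≤ (N : ℝ) ^ 2 * ‖d‖ ^ 2 := by
        have e : ∀ j, ‖X j - x j‖ ^ 2
            = if j = i then 0 else ((N : ℝ) / (N - 1)) ^ 2 * ‖d‖ ^ 2 := by
          intro j
          simp only [hX, add_sub_cancel_left]
          split_ifs
          · simp
          · rw [norm_smul, mul_pow, Real.norm_eq_abs, sq_abs]
        simp only [e]
        rw [Finset.sum_ite, Finset.sum_const_zero, zero_add, Finset.sum_const, Finset.filter_ne',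
          Finset.card_erase_of_mem (Finset.mem_univ i), Finset.card_univ, Fintype.card_fin,
          nsmul_eq_mul, Nat.cast_sub (by omega), ← mul_assoc]
        refine mul_le_mul_of_nonneg_right ?_ (sq_nonneg _)
        push_cast
        have : (N : ℝ) - 1 ≠ 0 := by linarith
        have e2 : ((N : ℝ) - 1) * (N / (N - 1)) ^ 2 = N ^ 2 / (N - 1) := by
          field_simp
        rw [e2]
        exact div_le_self (sq_nonneg _) hN1
      have h4 : 𝒢.pseudograd X i = 𝒢.extPseudograd i (x i) (u i) := by
        rw [h.pseudograd_eq, hXi, hXavg]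
      rw [h4] at h2
      have h5 := mul_le_mul_of_nonneg_left h3 (sq_nonneg l)
      calc _ ≤ _ := h2
        _ ≤ _ := h1
        _ ≤ _ := h5
        _ = _ := by ring
  refine le_of_sq_le_sq ?_ (by positivity)
  rw [mul_pow, PiLp.norm_sq_eq_of_L2, PiLp.norm_sq_eq_of_L2, Finset.mul_sum]
  exact Finset.sum_le_sum fun i _ => key i

end AggregativeGame

/-! ### Energy estimates for one primal-dual step. -/

section Lyapunov

variable {E H : Type*} [NormedAddCommGroup E] [InnerProductSpace ℝ E] [NormedAddCommGroup H]
  [InnerProductSpace ℝ H]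

/-- The quadratic form of the preconditioner of the primal-dual iteration. -/
noncomputable def precondForm (Ga : E →L[ℝ] E) (Gn Gd : H →L[ℝ] H) (A : E →L[ℝ] H)
    (L : H →L[ℝ] H) (p : E) (q r : H) : ℝ :=
  inner ℝ (Ga p) p + inner ℝ (Gn q) q + inner ℝ (Gd r) r - 2 * inner ℝ (A p) r + 2 * inner ℝ (L q) r

variable {Ga : E →L[ℝ] E} {Gn Gd : H →L[ℝ] H} {A : E →L[ℝ] H} {L : H →L[ℝ] H}

theorem precondForm_descent (hGa : ∀ x y, inner ℝ (Ga x) y = inner ℝ x (Ga y))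
    (hGn : ∀ x y, inner ℝ (Gn x) y = inner ℝ x (Gn y))
    (hGd : ∀ x y, inner ℝ (Gd x) y = inner ℝ x (Gd y))
    (hL : ∀ x y, inner ℝ (L x) y = inner ℝ x (L y)) {p d R : E} {q e r f : H}
    (h1 : 0 ≤ inner ℝ (-(Ga d) - R) p - inner ℝ (r - f) (A p))
    (h2 : 0 ≤ inner ℝ (-(Gd f) + A (p + d) - L (q + e)) r) (h3 : Gn e = L (r - f)) :
    precondForm Ga Gn Gd A L p q r ≤ precondForm Ga Gn Gd A L (p - d) (q - e) (r - f)
      - precondForm Ga Gn Gd A L d e f - 2 * inner ℝ R p := by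
  have h3' : inner ℝ (Gn e) q = inner ℝ (L q) r - inner ℝ (L q) f := by
    rw [h3, hL, real_inner_comm, inner_sub_right]
  have e1 : inner ℝ (Ga p) d = inner ℝ (Ga d) p := by rw [hGa, real_inner_comm]
  have e2 : inner ℝ (Gn q) e = inner ℝ (Gn e) q := by rw [hGn, real_inner_comm]
  have e3 : inner ℝ (Gd r) f = inner ℝ (Gd f) r := by rw [hGd, real_inner_comm]
  have e4 : inner ℝ (r - f) (A p) = inner ℝ (A p) r - inner ℝ (A p) f := by
    rw [real_inner_comm, inner_sub_right]
  rw [e4] at h1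
  simp only [precondForm, map_sub, map_add, inner_sub_left, inner_sub_right, inner_add_left,
    inner_neg_left] at *
  linarith

theorem precondForm_lower {K a b : ℝ} (hA : ∀ x, ‖A x‖ ≤ a * ‖x‖) (hL : ∀ x, ‖L x‖ ≤ b * ‖x‖)
    (hGa : ∀ x, (K + a) * ‖x‖ ^ 2 ≤ inner ℝ (Ga x) x) (hGn : ∀ x, b * ‖x‖ ^ 2 ≤ inner ℝ (Gn x) x)
    (hGd : ∀ x, (a + b) * ‖x‖ ^ 2 ≤ inner ℝ (Gd x) x) (ha : 0 ≤ a) (hb : 0 ≤ b)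
    (p : E) (q r : H) : K * ‖p‖ ^ 2 ≤ precondForm Ga Gn Gd A L p q r := by
  have h1 : inner ℝ (A p) r ≤ a * (‖p‖ * ‖r‖) := by
    calc _ ≤ ‖A p‖ * ‖r‖ := real_inner_le_norm _ _
      _ ≤ a * ‖p‖ * ‖r‖ := by gcongr; exact hA p
      _ = _ := by ring
  have h2 : -(b * (‖q‖ * ‖r‖)) ≤ inner ℝ (L q) r := by
    have : ‖L q‖ * ‖r‖ ≤ b * ‖q‖ * ‖r‖ := by gcongr; exact hL q
    have := neg_le_of_abs_le (abs_real_inner_le_norm (L q) r)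
    linarith
  have h3 := hGa p
  have h4 := hGn q
  have h5 := hGd r
  have h6 := mul_nonneg ha (sq_nonneg (‖p‖ - ‖r‖))
  have h7 := mul_nonneg hb (sq_nonneg (‖q‖ - ‖r‖))
  rw [precondForm]
  nlinarith

/-- Strong monotonicity gives `-2 η ‖c‖²`, of which Young's inequality spends half on the cross
terms. The noise is paired with the old error `c`, independent of the current batch; its product
with the increment `d`, which depends on the batch, is absorbed into `‖ε‖² + ‖d‖²`. -/
theorem gradient_step_bound {η l l' b : ℝ} (hη : 0 < η) {F F' Fs c d v ε Lu : E} (hmono : η * ‖c‖ ^ 2 ≤ inner ℝ (F - Fs) c)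
    (hlip : ‖F - Fs‖ ≤ l * ‖c‖) (hlip' : ‖F' - F‖ ≤ l' * ‖v‖) (hLu : ‖Lu‖ ≤ b * ‖v‖) :
    -2 * inner ℝ (F' + ε - Fs + Lu) (c + d) ≤
      -(η * ‖c‖ ^ 2) + (2 * (l' + b) ^ 2 / η + (l' + b) ^ 2) * ‖v‖ ^ 2
        + (2 * l ^ 2 / η + 2) * ‖d‖ ^ 2 + ‖ε‖ ^ 2 - 2 * inner ℝ ε c := by
  set q := l' + b with hq
  set y := (F' - F) + Lu with hy
  have hyn : ‖y‖ ≤ q * ‖v‖ := (norm_add_le _ _).trans (by rw [hq]; linarith)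
  have e1 : F' + ε - Fs + Lu = (F - Fs) + y + ε := by rw [hy]; abel
  have h1 : -(q * ‖v‖ * ‖c‖) ≤ inner ℝ y c := by
    have := neg_le_of_abs_le (abs_real_inner_le_norm y c)
    nlinarith [norm_nonneg c]
  have h2 : -(q * ‖v‖ * ‖d‖) ≤ inner ℝ y d := by
    have := neg_le_of_abs_le (abs_real_inner_le_norm y d)
    nlinarith [norm_nonneg d]
  have h3 : -(l * ‖c‖ * ‖d‖) ≤ inner ℝ (F - Fs) d := by
    have := neg_le_of_abs_le (abs_real_inner_le_norm (F - Fs) d)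
    nlinarith [norm_nonneg d]
  have h4 : -(‖ε‖ * ‖d‖) ≤ inner ℝ ε d := neg_le_of_abs_le (abs_real_inner_le_norm ε d)
  have y1 : 2 * (q * ‖v‖ * ‖c‖) ≤ η / 2 * ‖c‖ ^ 2 + 2 * q ^ 2 / η * ‖v‖ ^ 2 := by
    have : 0 ≤ (η * ‖c‖ - 2 * (q * ‖v‖)) ^ 2 / (2 * η) := by positivity
    have e : (η * ‖c‖ - 2 * (q * ‖v‖)) ^ 2 / (2 * η)
        = η / 2 * ‖c‖ ^ 2 + 2 * q ^ 2 / η * ‖v‖ ^ 2 - 2 * (q * ‖v‖ * ‖c‖) := by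
      field_simp; ring
    linarith
  have y2 : 2 * (l * ‖c‖ * ‖d‖) ≤ η / 2 * ‖c‖ ^ 2 + 2 * l ^ 2 / η * ‖d‖ ^ 2 := by
    have : 0 ≤ (η * ‖c‖ - 2 * (l * ‖d‖)) ^ 2 / (2 * η) := by positivity
    have e : (η * ‖c‖ - 2 * (l * ‖d‖)) ^ 2 / (2 * η)
        = η / 2 * ‖c‖ ^ 2 + 2 * l ^ 2 / η * ‖d‖ ^ 2 - 2 * (l * ‖c‖ * ‖d‖) := by
      field_simp; ring
    linarith
  have y3 : 2 * (q * ‖v‖ * ‖d‖) ≤ q ^ 2 * ‖v‖ ^ 2 + ‖d‖ ^ 2 := by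
    nlinarith [sq_nonneg (q * ‖v‖ - ‖d‖)]
  have y4 : 2 * (‖ε‖ * ‖d‖) ≤ ‖ε‖ ^ 2 + ‖d‖ ^ 2 := by nlinarith [sq_nonneg (‖ε‖ - ‖d‖)]
  rw [e1]
  simp only [inner_add_left, inner_add_right]
  nlinarith

end Lyapunov

theorem smul_inv_smul_add {E : Type*} [AddCommGroup E] [Module ℝ E] {a : ℝ} (ha : a ≠ 0)
    (u v : E) : a • (a⁻¹ • u + v) = u + a • v := by
  rw [smul_add, smul_smul, mul_inv_cancel₀ ha, one_smul]

theorem prof_inner_eq {N k : ℕ} (x y : Prof N k) : inner ℝ x y = ∑ i, inner ℝ (x i) (y i) :=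
  PiLp.inner_apply x y

/-! ### Block operators and the orthant projection. -/

section BlockOperators

variable {N k k' : ℕ}

/-- The block-diagonal operator acting as `A i` on component `i`. -/
noncomputable def blockCLM (A : Fin N → (Vec k →L[ℝ] Vec k')) : Prof N k →L[ℝ] Prof N k' where
  toFun y := WithLp.toLp 2 (fun i => A i (y i))
  map_add' x y := by
    ext i : 1
    simp
  map_smul' c x := by
    ext i : 1
    simp
  cont := by fun_prop

theorem blockCLM_apply (A : Fin N → (Vec k →L[ℝ] Vec k')) (y : Prof N k) (i : Fin N) :
    blockCLM A y i = A i (y i) := rfl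

/-- Scaling of the components of a family of vectors. -/
noncomputable def scaleCLM (k : ℕ) (a : Fin N → ℝ) : Prof N k →L[ℝ] Prof N k :=
  blockCLM fun i => a i • ContinuousLinearMap.id ℝ (Vec k)

theorem scaleCLM_apply (a : Fin N → ℝ) (y : Prof N k) (i : Fin N) :
    scaleCLM k a y i = a i • y i := rfl

theorem scaleCLM_symm (a : Fin N → ℝ) (x y : Prof N k) :
    inner ℝ (scaleCLM k a x) y = inner ℝ x (scaleCLM k a y) := by
  simp only [prof_inner_eq, scaleCLM_apply, real_inner_smul_left, real_inner_smul_right]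

theorem le_inner_scaleCLM {a : Fin N → ℝ} {c : ℝ} (h : ∀ i, c ≤ a i) (x : Prof N k) :
    c * ‖x‖ ^ 2 ≤ inner ℝ (scaleCLM k a x) x := by
  rw [PiLp.norm_sq_eq_of_L2, PiLp.inner_apply, Finset.mul_sum]
  refine Finset.sum_le_sum fun i _ => ?_
  rw [scaleCLM_apply, real_inner_smul_left, real_inner_self_eq_norm_sq]
  exact mul_le_mul_of_nonneg_right (h i) (sq_nonneg _)

end BlockOperators

theorem projNonneg_nonneg {m : ℕ} (v : Vec m) (r : Fin m) : 0 ≤ projNonneg v r := le_max_right _ _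

theorem projNonneg_variational {m : ℕ} (v μ : Vec m) (hμ : ∀ r, 0 ≤ μ r) :
    inner ℝ (v - projNonneg v) (μ - projNonneg v) ≤ 0 := by
  rw [PiLp.inner_apply]
  refine Finset.sum_nonpos fun r _ => ?_
  simp only [RCLike.inner_apply, conj_trivial, PiLp.sub_apply, projNonneg]
  rcases le_total (v r) 0 with h | h
  · rw [max_eq_right h]
    nlinarith [hμ r]
  · rw [max_eq_left h]
    simp

/-- A path of the node-based algorithm with gradient estimates `D k`. -/
structure IsNodePath {N n m : ℕ} {Ξ : Fin N → Type*} [∀ i, MeasurableSpace (Ξ i)]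
    (𝒢 : AggregativeGame N n m Ξ) (G : SimpleGraph (Fin N)) [DecidableRel G.Adj]
    (w : Fin N → Fin N → ℝ) (α : Fin N → ℝ) (γ : ℝ) (ν δ : Fin N → ℝ) (D : ℕ → Prof N n)
    (x s : ℕ → Prof N n) (z lam : ℕ → Prof N m) : Prop where
  init_x : ∀ i, x 0 i ∈ 𝒢.Ω i
  init_s : s 0 = 0
  init_lam : ∀ i r, 0 ≤ lam 0 i r
  step_x : ∀ k i, IsProx (𝒢.Ω i) (𝒢.g i) (α i)
    (x k i - α i • (D k i + (𝒢.A i).adjoint (lam k i) + lapCLM G w n (x k + s k) i)) (x (k + 1) i)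
  step_s : ∀ k, s (k + 1) = s k - γ • lapCLM G w n (x k + s k)
  step_z : ∀ k i, z (k + 1) i = z k i + ν i • lapCLM G w m (lam k) i
  step_lam : ∀ k i, lam (k + 1) i = projNonneg (lam k i
    + δ i • (𝒢.A i ((2 : ℝ) • x (k + 1) i - x k i) - 𝒢.b i)
    - δ i • ((2 : ℝ) • lapCLM G w m (z (k + 1)) i - lapCLM G w m (z k) i))

/-! ### Deterministic inequalities along a path. -/

namespace IsNodePath

variable {N n m : ℕ} {Ξ : Fin N → Type*} [∀ i, MeasurableSpace (Ξ i)]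
  {𝒢 : AggregativeGame N n m Ξ} {G : SimpleGraph (Fin N)} [DecidableRel G.Adj]
  {w : Fin N → Fin N → ℝ} {α : Fin N → ℝ} {γ : ℝ} {ν δ : Fin N → ℝ} {D x s : ℕ → Prof N n}
  {z lam : ℕ → Prof N m}

theorem mem_domain (h : IsNodePath 𝒢 G w α γ ν δ D x s z lam) (k : ℕ) : x k ∈ 𝒢.profDomain := by
  intro i
  cases k with
  | zero => exact h.init_x i
  | succ k => exact (h.step_x k i).1

theorem lam_nonneg (h : IsNodePath 𝒢 G w α γ ν δ D x s z lam) (k : ℕ) (i : Fin N) (r : Fin m) :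
    0 ≤ lam k i r := by
  cases k with
  | zero => exact h.init_lam i r
  | succ k => rw [h.step_lam]; exact projNonneg_nonneg _ _

theorem sum_s (hw : ∀ i j, w i j = w j i) (h : IsNodePath 𝒢 G w α γ ν δ D x s z lam) (k : ℕ) :
    ∑ i, s k i = 0 := by
  induction k with
  | zero => simp [h.init_s]
  | succ k ih =>
    rw [h.step_s]
    simp only [PiLp.sub_apply, PiLp.smul_apply, Finset.sum_sub_distrib, ← Finset.smul_sum, ih,
      sum_lapCLM G w hw, smul_zero, sub_zero]

theorem avg_estimate (hw : ∀ i j, w i j = w j i) (h : IsNodePath 𝒢 G w α γ ν δ D x s z lam)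
    (k : ℕ) : avg (x k + s k : Prof N n) = avg (x k) := by
  have h1 : avg (s k) = 0 := by rw [avg, h.sum_s hw, smul_zero]
  have h2 := avg_add (x k).ofLp (s k).ofLp
  rw [h1, add_zero] at h2
  exact h2

/-- The Laplacian sees only the disagreement and has zero mean, so the gossip contraction applies to
it; the new decision adds at most its increment, since removing the mean does not increase norms. -/
theorem disagreement_step (hN : 0 < N) (hw : ∀ i j, w i j = w j i) {θ : ℝ}
    (hθ : ∀ y : Prof N n, ∑ i, y i = 0 → ‖y - γ • lapCLM G w n y‖ ≤ θ * ‖y‖)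
    (h : IsNodePath 𝒢 G w α γ ν δ D x s z lam) (k : ℕ) :
    ‖x (k + 1) + s (k + 1) - meanCLM N n (x (k + 1) + s (k + 1))‖
      ≤ θ * ‖x k + s k - meanCLM N n (x k + s k)‖ + ‖x (k + 1) - x k‖ := by
  set J := meanCLM N n with hJ
  set L := lapCLM G w n with hL
  set v := x k + s k - J (x k + s k) with hv
  set d := x (k + 1) - x k with hd
  have h1 : x (k + 1) + s (k + 1) = x k + s k + d - γ • L (x k + s k) := by
    rw [h.step_s, hd]; abel
  have hJL : J (L (x k + s k)) = 0 := (meanCLM_eq_zero_iff hN _).2 (sum_lapCLM G w hw _)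
  have hLv : L v = L (x k + s k) := by rw [hv, map_sub, hL, hJ, lapCLM_meanCLM, sub_zero]
  have h2 : x (k + 1) + s (k + 1) - J (x (k + 1) + s (k + 1)) = (v - γ • L v) + (d - J d) := by
    rw [h1, hLv, map_sub, map_add J, map_smul, hJL, hv]
    simp only [smul_zero]
    abel
  have hv0 : ∑ i, v i = 0 := by
    rw [← meanCLM_eq_zero_iff hN, ← hJ, hv, map_sub, hJ, meanCLM_meanCLM hN, sub_self]
  rw [h2]
  exact (norm_add_le _ _).trans (add_le_add (hθ v hv0) (norm_sub_meanCLM_le hN d))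

/-- In each block the proximal inequality is tested at the equilibrium and the KKT subgradient
inequality at the new iterate; the values of `g i` cancel. -/
theorem primal_inequality (h𝒢 : 𝒢.Assumptions) (hα : ∀ i, 0 < α i) {xs : Fin N → Vec n}
    {ls : Vec m} (hk : 𝒢.IsKKT xs ls) (h : IsNodePath 𝒢 G w α γ ν δ D x s z lam) (k : ℕ) :
    0 ≤ inner ℝ (-(scaleCLM n (fun i => (α i)⁻¹) (x (k + 1) - x k))
        - (D k - 𝒢.profGrad (WithLp.toLp 2 xs) + lapCLM G w n (x k + s k)))
          (x (k + 1) - WithLp.toLp 2 xs)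
      - inner ℝ (lam k - WithLp.toLp 2 fun _ => ls)
          (blockCLM 𝒢.A (x (k + 1) - WithLp.toLp 2 xs)) := by
  rw [prof_inner_eq, prof_inner_eq, ← Finset.sum_sub_distrib]
  refine Finset.sum_nonneg fun i _ => ?_
  obtain ⟨hmem, hmin⟩ := h.step_x k i
  set v := D k i + (𝒢.A i).adjoint (lam k i) + lapCLM G w n (x k + s k) i with hv
  have h1 := prox_variational ((h𝒢.g_convex i).smul (hα i).le) hmem hmin (xs i) (hk.stationary i).1
  have h2 := (hk.stationary i).2 _ hmem
  simp only [smul_eq_mul] at h1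
  set p := x (k + 1) i with hp
  have h3 : inner ℝ (x k i - α i • v - p) (xs i - p)
      = α i * inner ℝ ((α i)⁻¹ • (p - x k i) + v) (p - xs i) := by
    rw [← real_inner_smul_left, smul_inv_smul_add (hα i).ne', ← inner_neg_neg]
    congr 1 <;> abel
  rw [h3] at h1
  have h4 : 𝒢.g i p + inner ℝ ((α i)⁻¹ • (p - x k i) + v) (p - xs i) ≤ 𝒢.g i (xs i) := by
    refine le_of_mul_le_mul_left ?_ (hα i)
    linarith
  have h5 : inner ℝ ((α i)⁻¹ • (p - x k i) + v) (p - xs i)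
      + inner ℝ (-(𝒢.pseudograd xs i + (𝒢.A i).adjoint ls)) (p - xs i) ≤ 0 := by linarith
  simp only [PiLp.sub_apply, PiLp.neg_apply, PiLp.add_apply, scaleCLM_apply, blockCLM_apply,
    AggregativeGame.profGrad]
  rw [← ContinuousLinearMap.adjoint_inner_left, map_sub, ← inner_sub_left, ← neg_nonpos,
    ← inner_neg_left]
  rw [← inner_add_left] at h5
  refine le_of_eq_of_le ?_ h5
  congr 1
  rw [hv]
  abel

/-- The projection inequality is tested at the common multiplier and the local complementarity at
the new one. Extrapolation makes each residual the new error plus the increment, the form required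
by `precondForm_descent`. -/
theorem dual_inequality (hδ : ∀ i, 0 < δ i) {xs : Fin N → Vec n}
    {ls : Vec m} (hls : ∀ r, 0 ≤ ls r) {zs : Prof N m}
    (hzs : ∀ μ : Vec m, (∀ r, 0 ≤ μ r) → ∀ i,
      inner ℝ (𝒢.A i (xs i) - 𝒢.b i - lapCLM G w m zs i) (μ - ls) ≤ 0)
    (h : IsNodePath 𝒢 G w α γ ν δ D x s z lam) (k : ℕ) :
    0 ≤ inner ℝ (-(scaleCLM m (fun i => (δ i)⁻¹) (lam (k + 1) - lam k))
        + blockCLM 𝒢.A ((x (k + 1) - WithLp.toLp 2 xs) + (x (k + 1) - x k))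
        - lapCLM G w m ((z (k + 1) - zs) + (z (k + 1) - z k)))
      (lam (k + 1) - WithLp.toLp 2 fun _ => ls) := by
  rw [PiLp.inner_apply]
  refine Finset.sum_nonneg fun i _ => ?_
  set q := lam (k + 1) i with hq
  set v := 𝒢.A i ((2 : ℝ) • x (k + 1) i - x k i) - 𝒢.b i
    - ((2 : ℝ) • lapCLM G w m (z (k + 1)) i - lapCLM G w m (z k) i) with hv
  have hstep : q = projNonneg (lam k i + δ i • v) := by
    rw [hq, h.step_lam, hv, smul_sub (δ i) (_ - _), add_sub_assoc]
  have h1 := projNonneg_variational (lam k i + δ i • v) ls hls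
  rw [← hstep] at h1
  have h2 := hzs q (fun r => h.lam_nonneg (k + 1) i r) i
  have h3 : inner ℝ (lam k i + δ i • v - q) (ls - q)
      = -(δ i * inner ℝ (-((δ i)⁻¹ • (q - lam k i)) + v) (q - ls)) := by
    rw [← real_inner_smul_left, ← smul_neg, smul_inv_smul_add (hδ i).ne', ← inner_neg_right]
    congr 1 <;> abel
  rw [h3, neg_nonpos] at h1
  have h4 := nonneg_of_mul_nonneg_right h1 (hδ i)
  have h5 : 0 ≤ inner ℝ (-((δ i)⁻¹ • (q - lam k i)) + v
      - (𝒢.A i (xs i) - 𝒢.b i - lapCLM G w m zs i)) (q - ls) := by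
    rw [inner_sub_left]; linarith
  refine h5.trans_eq ?_
  simp only [PiLp.sub_apply, PiLp.neg_apply, PiLp.add_apply, scaleCLM_apply, blockCLM_apply,
    map_sub, map_add]
  congr 1
  rw [hv]
  simp only [map_sub, map_smul]
  module

end IsNodePath

/-! ### The Lyapunov function and the step sizes. -/

namespace AggregativeGame

variable {N n m : ℕ} {Ξ : Fin N → Type*} [∀ i, MeasurableSpace (Ξ i)]
  {𝒢 : AggregativeGame N n m Ξ}

/-- The Lyapunov function of the algorithm at a state with vanishing tracking variables. -/
noncomputable def lyapunov (𝒢 : AggregativeGame N n m Ξ) (G : SimpleGraph (Fin N))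
    [DecidableRel G.Adj] (w : Fin N → Fin N → ℝ) (α ν δ : Fin N → ℝ) (κ : ℝ) (xs : Prof N n)
    (zs ls : Prof N m) (x u : Prof N n) (z l : Prof N m) : ℝ :=
  precondForm (scaleCLM n fun i => (α i)⁻¹) (scaleCLM m fun i => (ν i)⁻¹)
    (scaleCLM m fun i => (δ i)⁻¹) (blockCLM 𝒢.A) (lapCLM G w m) (x - xs) (z - zs) (l - ls)
  + κ * ‖u - meanCLM N n u‖ ^ 2

set_option maxHeartbeats 1000000 in
/-- Sufficiently small primal and dual steps and a suitable tracking step make the algorithm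
descend along a Lyapunov function up to the gradient errors, and keep the estimates bounded. -/
theorem Assumptions.exists_stepsizes (h𝒢 : 𝒢.Assumptions) {G : SimpleGraph (Fin N)}
    [DecidableRel G.Adj] (hG : G.Connected) {w : Fin N → Fin N → ℝ} (hw : ∀ i j, w i j = w j i)
    (hp : ∀ i j, G.Adj i j → 0 < w i j) {xs : Fin N → Vec n} {ls : Vec m}
    (hk : 𝒢.IsKKT xs ls) :
    ∃ αbar νbar δbar γ R η : ℝ, 0 < αbar ∧ 0 < νbar ∧ 0 < δbar ∧ 0 < γ ∧ 0 < η ∧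
      ∀ α ν δ : Fin N → ℝ, (∀ i, α i ∈ Set.Ioo 0 αbar) → (∀ i, ν i ∈ Set.Ioo 0 νbar) →
        (∀ i, δ i ∈ Set.Ioo 0 δbar) →
      ∃ V : Prof N n → Prof N m → Prof N m → ℝ,
        Continuous (fun p : Prof N n × Prof N m × Prof N m => V p.1 p.2.1 p.2.2) ∧
        ∀ (D x s : ℕ → Prof N n) (z lam : ℕ → Prof N m),
          IsNodePath 𝒢 G w α γ ν δ D x s z lam →
          (∀ k i, ‖(x k + s k) i‖ ≤ R) ∧
          ∀ K, η * ∑ k ∈ Finset.range K, ‖x k - WithLp.toLp 2 xs‖ ^ 2 ≤ V (x 0) (z 0) (lam 0)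
            + ∑ k ∈ Finset.range K, (‖D k - 𝒢.profExtGrad (x k) (x k + s k)‖ ^ 2
              - 2 * inner ℝ (D k - 𝒢.profExtGrad (x k) (x k + s k))
                  (x k - WithLp.toLp 2 xs)) := by
  have hN : 0 < N := by
    obtain ⟨i⟩ := hG.nonempty
    exact i.pos
  obtain ⟨η, hη, hmono⟩ := h𝒢.profGrad_monotone
  obtain ⟨l, hl, hlip⟩ := h𝒢.profGrad_lipschitz
  obtain ⟨l', hl', hlip'⟩ := h𝒢.profExtGrad_lipschitz hN
  obtain ⟨γ, θ, hγ, hθ0, hθ1, hθ⟩ := exists_gossip_contraction hG hw hp n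
  obtain ⟨zs, hzs⟩ := hk.exists_dual_consensus hN hG hw hp
  obtain ⟨B, hB, hBx⟩ := h𝒢.isCompact_profDomain.isBounded.exists_pos_norm_le
  set X : Prof N n := WithLp.toLp 2 xs with hX
  set Λ : Prof N m := WithLp.toLp 2 (fun _ => ls) with hΛ
  have hXmem : X ∈ 𝒢.profDomain := hk.feasible.1
  set a := ‖blockCLM 𝒢.A‖ with ha
  set b := ‖lapCLM G w m‖ with hb
  set b' := ‖lapCLM G w n‖ with hb'
  have hθ' : 0 < 1 - θ := by linarith
  set C := 2 * (l' + b') ^ 2 / η + (l' + b') ^ 2 with hC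
  have hC0 : 0 ≤ C := by positivity
  -- Contraction of the disagreement saves `κ (1 - θ) = C`, the coefficient of `‖v‖²` in
  -- `gradient_step_bound`; `K₀` collects the coefficients of the squared primal increment.
  set κ := C / (1 - θ) with hκ
  have hκ0 : 0 ≤ κ := by positivity
  set K₀ := 2 * l ^ 2 / η + 2 + κ / (1 - θ) with hK₀
  have hK₀0 : 0 < K₀ := by positivity
  have ha0 : 0 ≤ a := norm_nonneg _
  have hb0 : 0 ≤ b := norm_nonneg _
  have hinv : ∀ (c : ℝ), 0 < c → ∀ β : Fin N → ℝ, (∀ i, β i ∈ Set.Ioo 0 c⁻¹) →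
      ∀ i, c ≤ (β i)⁻¹ := fun c hc β hβ i => by
    rw [le_inv_comm₀ hc (hβ i).1]; exact (hβ i).2.le
  -- These are the diagonal bounds of `precondForm_lower`; the `+ 1` keeps the dual ones positive if
  -- the operators vanish. The radius is independent of the steps `α`, `ν`, `δ`.
  refine ⟨(K₀ + a)⁻¹, (b + 1)⁻¹, (a + b + 1)⁻¹, γ,
    2 * B / (1 - θ) + B + ‖meanCLM N n‖ * B, η, by positivity, by positivity, by positivity, hγ,
    hη, fun α ν δ hα hν hδ => ⟨fun x z lam => 𝒢.lyapunov G w α ν δ κ X zs Λ x x z lam, ?_,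
      fun D x s z lam hpath => ⟨fun k i => ?_, fun K => ?_⟩⟩⟩
  · unfold lyapunov precondForm
    fun_prop
  -- The recursion `v' ≤ θ v + 2 B` preserves this bound.
  · have hv : ∀ k, ‖x k + s k - meanCLM N n (x k + s k)‖ ≤ 2 * B / (1 - θ) + B := by
      intro k
      induction k with
      | zero =>
        rw [hpath.init_s, add_zero]
        have h1 := norm_sub_meanCLM_le hN (x 0)
        have h2 := hBx _ (hpath.mem_domain 0)
        have h3 : 0 ≤ 2 * B / (1 - θ) := by positivity
        linarith
      | succ k ih =>
        have h1 := hpath.disagreement_step hN hw hθ k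
        have h2 := norm_sub_le (x (k + 1)) (x k)
        have h3 := hBx _ (hpath.mem_domain (k + 1))
        have h4 := hBx _ (hpath.mem_domain k)
        have h5 := mul_le_mul_of_nonneg_left ih hθ0
        have h6 : θ * (2 * B / (1 - θ) + B) + 2 * B = 2 * B / (1 - θ) + θ * B := by
          field_simp; ring
        nlinarith
    have h1 : x k + s k = (x k + s k - meanCLM N n (x k + s k)) + meanCLM N n (x k) := by
      have : meanCLM N n (x k + s k) = meanCLM N n (x k) := by
        ext j : 1
        exact hpath.avg_estimate hw k
      rw [this]; abel
    have h2 : ‖meanCLM N n (x k)‖ ≤ ‖meanCLM N n‖ * B :=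
      ((meanCLM N n).le_opNorm _).trans
        (mul_le_mul_of_nonneg_left (hBx _ (hpath.mem_domain k)) (norm_nonneg _))
    calc ‖(x k + s k) i‖ ≤ ‖x k + s k‖ := PiLp.norm_apply_le _ _
      _ ≤ ‖x k + s k - meanCLM N n (x k + s k)‖ + ‖meanCLM N n (x k)‖ := by
          conv_lhs => rw [h1]
          exact norm_add_le _ _
      _ ≤ _ := add_le_add (hv k) h2
  · have hα' := hinv _ (by positivity) α hα
    have hν' := hinv _ (by positivity) ν hν
    have hδ' := hinv _ (by positivity) δ hδ
    have hlow : ∀ p q r, K₀ * ‖p‖ ^ 2 ≤ precondForm (scaleCLM n fun i => (α i)⁻¹)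
        (scaleCLM m fun i => (ν i)⁻¹) (scaleCLM m fun i => (δ i)⁻¹) (blockCLM 𝒢.A)
        (lapCLM G w m) p q r :=
      precondForm_lower (blockCLM 𝒢.A).le_opNorm (lapCLM G w m).le_opNorm (le_inner_scaleCLM hα')
        (le_inner_scaleCLM fun i => le_trans (by linarith) (hν' i))
        (le_inner_scaleCLM fun i => le_trans (by linarith) (hδ' i)) ha0 hb0
    set W : ℕ → ℝ := fun k => 𝒢.lyapunov G w α ν δ κ X zs Λ (x k) (x k + s k) (z k) (lam k) with hW
    have hWnn : ∀ k, 0 ≤ W k := fun k => by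
      have := hlow (x k - X) (z k - zs) (lam k - Λ)
      have h2 : 0 ≤ K₀ * ‖x k - X‖ ^ 2 := by positivity
      exact add_nonneg (h2.trans this) (by positivity)
    have hstep : ∀ k, W (k + 1) ≤ W k - η * ‖x k - X‖ ^ 2
        + (‖D k - 𝒢.profExtGrad (x k) (x k + s k)‖ ^ 2
          - 2 * inner ℝ (D k - 𝒢.profExtGrad (x k) (x k + s k)) (x k - X)) := by
      intro k
      set ε := D k - 𝒢.profExtGrad (x k) (x k + s k) with hε
      set v := x k + s k - meanCLM N n (x k + s k) with hv
      set d := x (k + 1) - x k with hd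
      have hrf : (lam (k + 1) - Λ) - (lam (k + 1) - lam k) = lam k - Λ := by abel
      have h3 : scaleCLM m (fun i => (ν i)⁻¹) (z (k + 1) - z k) = lapCLM G w m (lam k - Λ) := by
        rw [map_sub _ (lam k), lapCLM_const G w (y := Λ) (fun _ _ => rfl), sub_zero]
        ext i : 1
        rw [scaleCLM_apply, PiLp.sub_apply, hpath.step_z, add_sub_cancel_left, smul_smul,
          inv_mul_cancel₀ (hν i).1.ne', one_smul]
      have hdesc := precondForm_descent (scaleCLM_symm fun i => (α i)⁻¹)
        (scaleCLM_symm fun i => (ν i)⁻¹) (scaleCLM_symm fun i => (δ i)⁻¹) (lapCLM_symm G w hw)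
        (p := x (k + 1) - X) (d := d) (q := z (k + 1) - zs) (e := z (k + 1) - z k)
        (r := lam (k + 1) - Λ) (f := lam (k + 1) - lam k)
        (by rw [hrf]; exact hpath.primal_inequality h𝒢 (fun i => (hα i).1) hk k)
        (hpath.dual_inequality (fun i => (hδ i).1) hk.nonneg hzs k) (by rw [hrf]; exact h3)
      have e1 : x (k + 1) - X - d = x k - X := by rw [hd]; abel
      have e2 : z (k + 1) - zs - (z (k + 1) - z k) = z k - zs := by abel
      rw [e1, e2, hrf] at hdesc
      have hlip1 : ‖𝒢.profGrad (x k) - 𝒢.profGrad X‖ ≤ l * ‖x k - X‖ :=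
        le_of_sq_le_sq (by rw [mul_pow]; exact hlip _ _) (by positivity)
      have hLv : ‖lapCLM G w n (x k + s k)‖ ≤ b' * ‖v‖ := by
        have : lapCLM G w n (x k + s k) = lapCLM G w n v := by
          rw [hv, map_sub, lapCLM_meanCLM, sub_zero]
        rw [this]
        exact (lapCLM G w n).le_opNorm v
      have hgrad := gradient_step_bound hη (d := d) (ε := ε)
        (hmono _ (hpath.mem_domain k) _ hXmem) hlip1 (hlip' _ _ (hpath.avg_estimate hw k)) hLv
      have e3 : 𝒢.profExtGrad (x k) (x k + s k) + ε - 𝒢.profGrad X + lapCLM G w n (x k + s k)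
          = D k - 𝒢.profGrad X + lapCLM G w n (x k + s k) := by rw [hε]; abel
      have e4 : x k - X + d = x (k + 1) - X := by rw [hd]; abel
      rw [e3, e4, ← hC] at hgrad
      have hd' := hlow d (z (k + 1) - z k) (lam (k + 1) - lam k)
      have hcons := hpath.disagreement_step hN hw hθ k
      rw [← hv, ← hd] at hcons
      have hcons2 : ‖x (k + 1) + s (k + 1) - meanCLM N n (x (k + 1) + s (k + 1))‖ ^ 2
          ≤ θ * ‖v‖ ^ 2 + ‖d‖ ^ 2 / (1 - θ) := by
        refine (pow_le_pow_left₀ (norm_nonneg _) hcons 2).trans ?_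
        -- This square is the gap in the convexity estimate for `θ ‖v‖ + (1 - θ) (‖d‖ / (1 - θ))`.
        have : 0 ≤ θ * ((1 - θ) * ‖v‖ - ‖d‖) ^ 2 / (1 - θ) := by positivity
        have e : θ * ((1 - θ) * ‖v‖ - ‖d‖) ^ 2 / (1 - θ)
            = θ * ‖v‖ ^ 2 + ‖d‖ ^ 2 / (1 - θ) - (θ * ‖v‖ + ‖d‖) ^ 2 := by
          field_simp; ring
        linarith
      have hcons3 := mul_le_mul_of_nonneg_left hcons2 hκ0
      have e5 : κ * (θ * ‖v‖ ^ 2 + ‖d‖ ^ 2 / (1 - θ))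
          = κ * ‖v‖ ^ 2 - C * ‖v‖ ^ 2 + κ / (1 - θ) * ‖d‖ ^ 2 := by
        rw [hκ]; field_simp; ring
      rw [e5] at hcons3
      have e6 : K₀ * ‖d‖ ^ 2 = (2 * l ^ 2 / η + 2) * ‖d‖ ^ 2 + κ / (1 - θ) * ‖d‖ ^ 2 := by
        rw [hK₀]; ring
      rw [e6] at hd'
      simp only [hW, lyapunov]
      rw [← hv]
      linarith
    have hsum : ∀ K, W K + η * ∑ k ∈ Finset.range K, ‖x k - X‖ ^ 2 ≤ W 0
        + ∑ k ∈ Finset.range K, (‖D k - 𝒢.profExtGrad (x k) (x k + s k)‖ ^ 2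
          - 2 * inner ℝ (D k - 𝒢.profExtGrad (x k) (x k + s k)) (x k - X)) := by
      intro K
      induction K with
      | zero => simp
      | succ K ih =>
        rw [Finset.sum_range_succ, Finset.sum_range_succ, mul_add]
        have := hstep K
        linarith
    -- Since `s 0 = 0`, the starting value depends only on the initial decisions and dual variables.
    have hW0 : W 0 = 𝒢.lyapunov G w α ν δ κ X zs Λ (x 0) (x 0) (z 0) (lam 0) := by
      simp only [hW, hpath.init_s, add_zero]
    have h1 := hsum K
    have h2 := hWnn K
    rw [hW0] at h1
    linarith

end AggregativeGame

/-! ### Measurability of gradients and iterates. -/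

/-- The gradient need not be continuous, so its coordinates are obtained as pointwise limits of
jointly measurable difference quotients. -/
theorem measurable_gradient_with_param {Y : Type*} [MeasurableSpace Y] {n : ℕ}
    {F : Y → Vec n → ℝ} (hF : Measurable (fun p : Y × Vec n => F p.1 p.2))
    (hd : ∀ y, Differentiable ℝ (F y)) :
    Measurable (fun p : Y × Vec n => gradient (F p.1) p.2) := by
  have hdir : ∀ e : Vec n, Measurable (fun p : Y × Vec n => fderiv ℝ (F p.1) p.2 e) := by
    intro e
    refine measurable_of_tendsto_metrizable (f := fun (k : ℕ) (p : Y × Vec n) =>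
      (k : ℝ) • (F p.1 (p.2 + (k : ℝ)⁻¹ • e) - F p.1 p.2)) (fun k => ?_) ?_
    · have h2 : Measurable (fun p : Y × Vec n => (p.1, p.2 + (k : ℝ)⁻¹ • e)) := by fun_prop
      have h3 : Measurable (fun p : Y × Vec n => F p.1 (p.2 + (k : ℝ)⁻¹ • e)) := hF.comp h2
      exact (h3.sub hF).const_mul (k : ℝ)
    · rw [tendsto_pi_nhds]
      intro p
      exact (hd p.1 p.2).hasFDerivAt.lim e (by simpa using tendsto_natCast_atTop_atTop)
  have heq : (fun p : Y × Vec n => gradient (F p.1) p.2) = fun p =>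
      WithLp.toLp 2 (fun r => fderiv ℝ (F p.1) p.2 (EuclideanSpace.single r 1)) := by
    funext p
    ext r
    have : gradient (F p.1) p.2 r
        = inner ℝ (gradient (F p.1) p.2) (EuclideanSpace.single r (1 : ℝ)) := by
      rw [EuclideanSpace.inner_single_right]
      simp
    rw [this, gradient, InnerProductSpace.toDual_symm_apply]
  rw [heq]
  exact (WithLp.measurable_toLp 2 _).comp (measurable_pi_lambda _ fun r => hdir _)

namespace AggregativeGame

variable {N n m : ℕ} {Ξ : Fin N → Type*} [∀ i, MeasurableSpace (Ξ i)]
  {𝒢 : AggregativeGame N n m Ξ}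

theorem Assumptions.measurable_sampleGrad (h : 𝒢.Assumptions) (i : Fin N) :
    Measurable (fun p : (Vec n × Vec n) × Ξ i => 𝒢.sampleGrad i p.1.1 p.1.2 p.2) := by
  have hf : Measurable (fun q : (Vec n × Vec n) × Ξ i => 𝒢.f i q.1.1 q.1.2 q.2) :=
    measurable_uncurry_of_continuous_of_measurable
      (u := fun (q : Vec n × Vec n) ξ => 𝒢.f i q.1 q.2 ξ)
      (fun ξ => (h.f_differentiable i ξ).continuous) (fun q => h.f_measurable i q.1 q.2)
  have e1 : Measurable (fun p : (Vec n × Ξ i) × Vec n => ((p.2, p.1.1), p.1.2)) := by fun_prop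
  have e2 : Measurable (fun p : (Vec n × Ξ i) × Vec n => ((p.1.1, p.2), p.1.2)) := by fun_prop
  have h1 := measurable_gradient_with_param (F := fun (y : Vec n × Ξ i) t => 𝒢.f i t y.1 y.2)
    (hf.comp e1) (fun y => (h.f_differentiable i y.2).comp
      (differentiable_id.prodMk (differentiable_const y.1)))
  have h2 := measurable_gradient_with_param (F := fun (y : Vec n × Ξ i) t => 𝒢.f i y.1 t y.2)
    (hf.comp e2) (fun y => (h.f_differentiable i y.2).comp
      ((differentiable_const y.1).prodMk differentiable_id))
  have e3 : Measurable (fun p : (Vec n × Vec n) × Ξ i => ((p.1.2, p.2), p.1.1)) := by fun_prop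
  have e4 : Measurable (fun p : (Vec n × Vec n) × Ξ i => ((p.1.1, p.2), p.1.2)) := by fun_prop
  exact (h1.comp e3).add ((h2.comp e4).const_smul (1 / (N : ℝ)))

theorem Assumptions.measurable_sampleGrad_comp (h : 𝒢.Assumptions) (i : Fin N) {S : Type*}
    [MeasurableSpace S] {a b : S → Vec n} {c : S → Ξ i} (ha : Measurable a) (hb : Measurable b)
    (hc : Measurable c) : Measurable fun ω => 𝒢.sampleGrad i (a ω) (b ω) (c ω) := by
  have e : Measurable fun ω => ((a ω, b ω), c ω) := (ha.prodMk hb).prodMk hc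
  exact Measurable.comp (g := fun p : (Vec n × Vec n) × Ξ i => 𝒢.sampleGrad i p.1.1 p.1.2 p.2)
    (f := fun ω => ((a ω, b ω), c ω)) (h.measurable_sampleGrad i) e

theorem Assumptions.measurable_extPseudograd (h : 𝒢.Assumptions) (i : Fin N) :
    Measurable (fun p : Vec n × Vec n => 𝒢.extPseudograd i p.1 p.2) := by
  have := h.isProbabilityMeasure
  have e : Measurable (fun p : (Vec n × Vec n) × (∀ j, Ξ j) => (p.1, p.2 i)) := by fun_prop
  exact (((h.measurable_sampleGrad i).comp e).stronglyMeasurable.integral_prod_right'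
    (ν := 𝒢.P)).measurable

/-- The run specifies proximal points only as a relation; nonexpansiveness makes them single-valued
and continuous in `v`. -/
theorem Assumptions.exists_measurable_prox (h : 𝒢.Assumptions) (i : Fin N) {a : ℝ} (ha : 0 < a) :
    ∃ T : Vec n → Vec n, Measurable T ∧ ∀ v p, IsProx (𝒢.Ω i) (𝒢.g i) a v p → p = T v := by
  have hl : LowerSemicontinuousOn (fun y => a * 𝒢.g i y) (𝒢.Ω i) := fun x hx c hc => by
    have : c / a < 𝒢.g i x := by rwa [div_lt_iff₀ ha, mul_comm]
    filter_upwards [h.g_lsc i x hx _ this] with y hy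
    rwa [gt_iff_lt, div_lt_iff₀ ha, mul_comm] at hy
  have hc : ConvexOn ℝ (𝒢.Ω i) (fun y => a * 𝒢.g i y) := (h.g_convex i).smul ha.le
  choose T hTmem hTmin using exists_prox (h.isCompact i) (h.nonempty i) hl
  refine ⟨T, ?_, fun v p hp => ?_⟩
  · have : LipschitzWith 1 T := LipschitzWith.of_dist_le_mul fun v v' => by
      rw [dist_eq_norm, dist_eq_norm, NNReal.coe_one, one_mul]
      exact norm_sub_sq_le_of_prox hc (hTmem v) (hTmin v) (hTmem v') (hTmin v')
    exact this.continuous.measurable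
  · have := norm_sub_sq_le_of_prox hc hp.1 hp.2 (hTmem v) (hTmin v)
    rw [sub_self, norm_zero] at this
    exact sub_eq_zero.1 (norm_le_zero_iff.1 this)

end AggregativeGame

theorem continuous_projNonneg {m : ℕ} : Continuous (projNonneg (m := m)) := by
  unfold projNonneg
  fun_prop

theorem continuous_graphLap {N k : ℕ} (G : SimpleGraph (Fin N)) [DecidableRel G.Adj]
    (w : Fin N → Fin N → ℝ) : Continuous (fun y : Fin N → Vec k => graphLap G w y) := by
  unfold graphLap
  fun_prop

theorem Measurable.vec_clm_comp {S : Type*} [MeasurableSpace S] {a b : ℕ}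
    (T : Vec a →L[ℝ] Vec b) {f : S → Vec a} (hf : Measurable f) : Measurable fun ω => T (f ω) :=
  T.continuous.measurable.comp hf

theorem Measurable.vec_adjoint_comp {S : Type*} [MeasurableSpace S] {a b : ℕ}
    (T : Vec a →L[ℝ] Vec b) {f : S → Vec b} (hf : Measurable f) :
    Measurable fun ω => T.adjoint (f ω) := by
  generalize T.adjoint = U
  exact hf.vec_clm_comp U

section Run

variable {N n m : ℕ} {Ξ : Fin N → Type*} [∀ i, MeasurableSpace (Ξ i)]
  {𝒢 : AggregativeGame N n m Ξ} {G : SimpleGraph (Fin N)} [DecidableRel G.Adj]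
  {w : Fin N → Fin N → ℝ} {α γ ν δ : Fin N → ℝ} {S : Type*} {M : ℕ → ℕ}
  {ζ : (k : ℕ) → Fin (M k) → S → (∀ i, Ξ i)} {x s : ℕ → S → Fin N → Vec n}
  {z lam : ℕ → S → Fin N → Vec m}

set_option maxHeartbeats 400000 in
/-- The iterates are measurable for every σ-algebra that makes the initial point and the samples
used so far measurable. -/
theorem IsNodeRun.measurable [MeasurableSpace S] (h𝒢 : 𝒢.Assumptions) (hα : ∀ i, 0 < α i)
    (h : IsNodeRun 𝒢 G w α γ ν δ M ζ x s z lam) (hx : Measurable (x 0)) (hz : Measurable (z 0))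
    (hlam : Measurable (lam 0)) (k : ℕ) (hζ : ∀ j < k, ∀ t, Measurable (ζ j t)) :
    Measurable (x k) ∧ Measurable (s k) ∧ Measurable (z k) ∧ Measurable (lam k) := by
  induction k with
  | zero =>
    refine ⟨hx, ?_, hz, hlam⟩
    have : s 0 = fun _ => 0 := by
      funext ω i
      exact h.init_s ω i
    rw [this]
    exact measurable_const
  | succ k ih =>
    obtain ⟨hx, hs, hz, hlam⟩ := ih fun j hj => hζ j (hj.trans k.lt_succ_self)
    have hζk := hζ k k.lt_succ_self
    have hL : Measurable fun ω => graphLap G w (x k ω + s k ω) :=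
      (continuous_graphLap G w).measurable.comp (hx.add hs)
    have hxi : ∀ i, Measurable fun ω => x k ω i := fun i => (measurable_pi_apply i).comp hx
    have hsi : ∀ i, Measurable fun ω => s k ω i := fun i => (measurable_pi_apply i).comp hs
    have hzi : ∀ i, Measurable fun ω => z k ω i := fun i => (measurable_pi_apply i).comp hz
    have hlami : ∀ i, Measurable fun ω => lam k ω i := fun i => (measurable_pi_apply i).comp hlam
    have hLi : ∀ i, Measurable fun ω => graphLap G w (x k ω + s k ω) i :=
      fun i => (measurable_pi_apply i).comp hL
    have hx' : Measurable (x (k + 1)) := by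
      refine measurable_pi_lambda _ fun i => ?_
      obtain ⟨T, hT, hTp⟩ := h𝒢.exists_measurable_prox i (hα i)
      have := fun ω => hTp _ _ (h.step_x k ω i)
      simp only [this]
      have h1 : ∀ t, Measurable fun ω =>
          𝒢.sampleGrad i (x k ω i) (x k ω i + s k ω i) (ζ k t ω i) := fun t =>
        h𝒢.measurable_sampleGrad_comp i (hxi i) ((hxi i).add (hsi i))
          ((measurable_pi_apply i).comp (hζk t))
      have h2 : Measurable fun ω => (𝒢.A i).adjoint (lam k ω i) :=
        Measurable.vec_adjoint_comp (𝒢.A i) (hlami i)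
      have h3 := hxi i
      have h4 := hLi i
      exact hT.comp (by fun_prop)
    have hLz : ∀ i, Measurable fun ω => graphLap G w (z k ω) i := fun i =>
      (measurable_pi_apply i).comp ((continuous_graphLap G w).measurable.comp hz)
    have hLlam : ∀ i, Measurable fun ω => graphLap G w (lam k ω) i := fun i =>
      (measurable_pi_apply i).comp ((continuous_graphLap G w).measurable.comp hlam)
    have hz' : Measurable (z (k + 1)) := by
      refine measurable_pi_lambda _ fun i => ?_
      simp only [h.step_z]
      have h1 := hzi i
      have h2 := hLlam i
      fun_prop
    refine ⟨hx', ?_, hz', ?_⟩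
    · refine measurable_pi_lambda _ fun i => ?_
      simp only [h.step_s]
      have h1 := hsi i
      have h2 := hLi i
      fun_prop
    · refine measurable_pi_lambda _ fun i => ?_
      simp only [h.step_lam]
      have h1 : Measurable fun ω => (2 : ℝ) • x (k + 1) ω i - x k ω i := by
        have h1 : Measurable fun ω => x (k + 1) ω i := (measurable_pi_apply i).comp hx'
        have h2 := hxi i
        fun_prop
      have h2 : Measurable fun ω => 𝒢.A i ((2 : ℝ) • x (k + 1) ω i - x k ω i) :=
        Measurable.vec_clm_comp (𝒢.A i) h1
      have h3 : Measurable fun ω => graphLap G w (z (k + 1) ω) i :=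
        (measurable_pi_apply i).comp ((continuous_graphLap G w).measurable.comp hz')
      have h4 := hLz i
      have h5 := hlami i
      exact continuous_projNonneg.measurable.comp (by fun_prop)

end Run

/-! ### Independence of the state from the current batch. -/

section Independence

theorem map_batch_eq_pi {S : Type*} [MeasurableSpace S] {μ : Measure S} {M : ℕ → ℕ} {Υ : Type*}
    [MeasurableSpace Υ] {ζ : (k : ℕ) → Fin (M k) → S → Υ} {P : Measure Υ} (hζ : ∀ k t, Measurable (ζ k t))
    (hlaw : ∀ k t, μ.map (ζ k t) = P)
    (hind : iIndepFun (fun (p : Σ k, Fin (M k)) => ζ p.1 p.2) μ) (k : ℕ) :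
    μ.map (fun ω t => ζ k t ω) = Measure.pi fun _ : Fin (M k) => P := by
  have h1 : iIndepFun (fun t : Fin (M k) => ζ k t) μ :=
    hind.precomp (g := fun t : Fin (M k) => (⟨k, t⟩ : Σ k, Fin (M k)))
      (fun _ _ h => eq_of_heq (Sigma.mk.inj h).2)
  rw [h1.map_fun_eq_pi_map fun t => (hζ k t).aemeasurable]
  simp only [hlaw]

variable {S : Type*} [MeasurableSpace S] {μ : Measure S} [IsProbabilityMeasure μ]

/-- The hypotheses factor the law of the triple completely, so it can be reassociated. -/
theorem ProbabilityTheory.IndepFun.prodMk_left {α β γ : Type*} [MeasurableSpace α]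
    [MeasurableSpace β] [MeasurableSpace γ] {X : S → α} {Y : S → β} {Z : S → γ}
    (hX : Measurable X) (hY : Measurable Y) (hZ : Measurable Z)
    (h1 : IndepFun X (fun ω => (Y ω, Z ω)) μ) (h2 : IndepFun Y Z μ) :
    IndepFun (fun ω => (X ω, Y ω)) Z μ := by
  have hXY : IndepFun X Y μ := h1.comp measurable_id measurable_fst
  have := Measure.isProbabilityMeasure_map (μ := μ) hX.aemeasurable
  have := Measure.isProbabilityMeasure_map (μ := μ) hY.aemeasurable
  have := Measure.isProbabilityMeasure_map (μ := μ) hZ.aemeasurable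
  rw [indepFun_iff_map_prod_eq_prod_map_map (hX.prodMk hY).aemeasurable hZ.aemeasurable,
    (indepFun_iff_map_prod_eq_prod_map_map hX.aemeasurable hY.aemeasurable).1 hXY]
  have e1 := (indepFun_iff_map_prod_eq_prod_map_map hX.aemeasurable
    (hY.prodMk hZ).aemeasurable).1 h1
  rw [(indepFun_iff_map_prod_eq_prod_map_map hY.aemeasurable hZ.aemeasurable).1 h2,
    ← Measure.prodAssoc_prod] at e1
  apply MeasurableEquiv.prodAssoc.map_measurableEquiv_injective
  rw [← e1, Measure.map_map MeasurableEquiv.prodAssoc.measurable ((hX.prodMk hY).prodMk hZ)]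
  rfl

variable {M : ℕ → ℕ} {Υ : Type*} [MeasurableSpace Υ] {ζ : (k : ℕ) → Fin (M k) → S → Υ}

/-- The indices of the samples drawn before iteration `k`. -/
def pastIndices (M : ℕ → ℕ) (k : ℕ) : Finset (Σ k, Fin (M k)) :=
  (Finset.range k).sigma fun _ => Finset.univ

theorem indepFun_past {I : Type*} [MeasurableSpace I] {ι : S → I} (hι : Measurable ι)
    (hζ : ∀ k t, Measurable (ζ k t))
    (hind : iIndepFun (fun (p : Σ k, Fin (M k)) => ζ p.1 p.2) μ)
    (hinit : IndepFun ι (fun ω (p : Σ k, Fin (M k)) => ζ p.1 p.2 ω) μ) (k : ℕ) :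
    IndepFun (fun ω => (ι ω, fun p : pastIndices M k => ζ p.1.1 p.1.2 ω))
      (fun ω t => ζ k t ω) μ := by
  have hsel : Measurable (fun q : (p : ↥(({k} : Finset ℕ).sigma
      fun k => (Finset.univ : Finset (Fin (M k))))) → Υ => fun t : Fin (M k) =>
        q ⟨⟨k, t⟩, by simp⟩) := by fun_prop
  have hdisj : Disjoint (pastIndices M k)
      (({k} : Finset ℕ).sigma fun k => (Finset.univ : Finset (Fin (M k)))) := by
    rw [Finset.disjoint_left]
    intro p hp hp'
    simp only [pastIndices, Finset.mem_sigma, Finset.mem_range, Finset.mem_singleton] at hp hp'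
    omega
  have h1 : IndepFun (fun ω (p : pastIndices M k) => ζ p.1.1 p.1.2 ω) (fun ω t => ζ k t ω) μ :=
    (iIndepFun.indepFun_finset _ _ hdisj hind fun p => hζ p.1 p.2).comp measurable_id hsel
  have hsel2 : Measurable (fun q : (Σ k, Fin (M k)) → Υ =>
      ((fun p : pastIndices M k => q p.1), fun t : Fin (M k) => q ⟨k, t⟩)) := by fun_prop
  refine IndepFun.prodMk_left hι (measurable_pi_lambda _ fun p => hζ _ _)
    (measurable_pi_lambda _ fun t => hζ _ _) ?_ h1
  exact hinit.comp measurable_id hsel2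

theorem ProbabilityTheory.IndepFun.lintegral_comp {α β : Type*} [MeasurableSpace α]
    [MeasurableSpace β] {Y : S → α} {Q : S → β} (hY : Measurable Y) (hQ : Measurable Q)
    (h : IndepFun Y Q μ) {φ : α × β → ENNReal} (hφ : Measurable φ) :
    ∫⁻ ω, φ (Y ω, Q ω) ∂μ = ∫⁻ ω, ∫⁻ q, φ (Y ω, q) ∂(μ.map Q) ∂μ := by
  have := Measure.isProbabilityMeasure_map (μ := μ) hQ.aemeasurable
  rw [← lintegral_map (f := φ) hφ (hY.prodMk hQ),
    (indepFun_iff_map_prod_eq_prod_map_map hY.aemeasurable hQ.aemeasurable).1 h,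
    lintegral_prod _ hφ.aemeasurable,
    lintegral_map (f := fun y => ∫⁻ q, φ (y, q) ∂(μ.map Q)) hφ.lintegral_prod_right' hY]

theorem ProbabilityTheory.IndepFun.integral_comp {α β : Type*} [MeasurableSpace α]
    [MeasurableSpace β] {Y : S → α} {Q : S → β} (hY : Measurable Y) (hQ : Measurable Q)
    (h : IndepFun Y Q μ) {φ : α × β → ℝ} (hφ : Measurable φ)
    (hint : Integrable (fun ω => φ (Y ω, Q ω)) μ) :
    ∫ ω, φ (Y ω, Q ω) ∂μ = ∫ ω, ∫ q, φ (Y ω, q) ∂(μ.map Q) ∂μ := by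
  have := Measure.isProbabilityMeasure_map (μ := μ) hQ.aemeasurable
  have := Measure.isProbabilityMeasure_map (μ := μ) hY.aemeasurable
  have e := (indepFun_iff_map_prod_eq_prod_map_map hY.aemeasurable hQ.aemeasurable).1 h
  have hint' : Integrable φ ((μ.map Y).prod (μ.map Q)) := by
    rw [← e]
    exact (integrable_map_measure hφ.aestronglyMeasurable (hY.prodMk hQ).aemeasurable).2 hint
  rw [← integral_map (f := φ) (hY.prodMk hQ).aemeasurable hφ.aestronglyMeasurable, e,
    integral_prod _ hint', integral_map (f := fun y => ∫ q, φ (y, q) ∂(μ.map Q)) hY.aemeasurable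
      hφ.stronglyMeasurable.integral_prod_right'.aestronglyMeasurable]

end Independence

/-! ### Second moments of batch averages. -/

theorem lintegral_enorm_sq_eq {S E : Type*} [MeasurableSpace S] {μ : Measure S}
    [NormedAddCommGroup E] {f : S → E} (hf : MemLp f 2 μ) :
    ∫⁻ ω, ‖f ω‖ₑ ^ 2 ∂μ = ENNReal.ofReal (∫ ω, ‖f ω‖ ^ 2 ∂μ) := by
  rw [ofReal_integral_eq_lintegral_ofReal ((memLp_two_iff_integrable_sq_norm hf.1).1 hf)
    (Eventually.of_forall fun ω => sq_nonneg _)]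
  refine lintegral_congr fun ω => ?_
  rw [ENNReal.ofReal_pow (norm_nonneg _), ofReal_norm]

theorem memLp_two_of_lintegral_le {S E : Type*} [MeasurableSpace S] {μ : Measure S}
    [NormedAddCommGroup E] {f : S → E} (hf : AEStronglyMeasurable f μ) {v : ℝ}
    (hv : ∫⁻ ω, ‖f ω‖ₑ ^ 2 ∂μ ≤ ENNReal.ofReal v) : MemLp f 2 μ := by
  refine (memLp_two_iff_integrable_sq_norm hf).2 ⟨(hf.norm.pow 2), ?_⟩
  rw [hasFiniteIntegral_iff_enorm]
  refine lt_of_le_of_lt (le_of_eq_of_le ?_ hv) ENNReal.ofReal_lt_top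
  refine lintegral_congr fun ω => ?_
  rw [enorm_pow, enorm_norm]

theorem integrable_inner_of_memLp {S E : Type*} [MeasurableSpace S] {μ : Measure S}
    [NormedAddCommGroup E] [InnerProductSpace ℝ E] {f g : S → E} (hf : MemLp f 2 μ)
    (hg : MemLp g 2 μ) : Integrable (fun ω => inner ℝ (f ω) (g ω)) μ := by
  refine Integrable.mono' (((memLp_two_iff_integrable_sq_norm hf.1).1 hf).add
    ((memLp_two_iff_integrable_sq_norm hg.1).1 hg)) (hf.1.inner hg.1)
    (Eventually.of_forall fun ω => ?_)
  rw [Real.norm_eq_abs]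
  refine (abs_real_inner_le_norm _ _).trans ?_
  simp only [Pi.add_apply]
  nlinarith [sq_nonneg (‖f ω‖ - ‖g ω‖), sq_nonneg (‖f ω‖), sq_nonneg (‖g ω‖)]

section Batch

variable {Υ : Type*} [MeasurableSpace Υ] {P : Measure Υ} [IsProbabilityMeasure P] {n M : ℕ}
  {g : Υ → Vec n}

theorem memLp_eval_pi (hg : MemLp g 2 P) (t : Fin M) :
    MemLp (fun q : Fin M → Υ => g (q t)) 2 (Measure.pi fun _ => P) :=
  hg.comp_measurePreserving (measurePreserving_eval (fun _ : Fin M => P) t)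

/-- Expanding the square leaves the diagonal: independent centred terms are orthogonal. -/
theorem integral_norm_sum_sq_pi (hgm : Measurable g) (hg : MemLp g 2 P) (h0 : ∫ ξ, g ξ ∂P = 0) :
    ∫ q : Fin M → Υ, ‖∑ t, g (q t)‖ ^ 2 ∂(Measure.pi fun _ => P)
      = M * ∫ ξ, ‖g ξ‖ ^ 2 ∂P := by
  have hL := fun t : Fin M => memLp_eval_pi hg t
  have hint := fun t t' : Fin M => integrable_inner_of_memLp (hL t) (hL t')
  have hmp := fun t : Fin M => measurePreserving_eval (fun _ : Fin M => P) t
  have hcross : ∀ t t' : Fin M, t' ≠ t →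
      ∫ q : Fin M → Υ, inner ℝ (g (q t)) (g (q t')) ∂(Measure.pi fun _ => P) = 0 := by
    intro t t' htt
    have hind : iIndepFun (fun (t : Fin M) (q : Fin M → Υ) => q t) (Measure.pi fun _ => P) :=
      iIndepFun_pi (X := fun _ ξ => ξ) fun _ => aemeasurable_id
    rw [IndepFun.integral_comp (Y := fun q : Fin M → Υ => q t) (Q := fun q : Fin M → Υ => q t')
      (φ := fun p : Υ × Υ => inner ℝ (g p.1) (g p.2)) (measurable_pi_apply t)
      (measurable_pi_apply t') (hind.indepFun htt.symm)
      ((hgm.comp measurable_fst).inner (hgm.comp measurable_snd)) (hint t t')]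
    have : Measure.map (fun q : Fin M → Υ => q t') (Measure.pi fun _ => P) = P := (hmp t').map_eq
    rw [this]
    have hz : ∀ y : Υ, ∫ ξ, inner ℝ (g y) (g ξ) ∂P = 0 := fun y => by
      rw [integral_inner (hg.integrable one_le_two), h0, inner_zero_right]
    simp only [hz, integral_zero]
  have hdiag : ∀ t : Fin M,
      ∫ q : Fin M → Υ, inner ℝ (g (q t)) (g (q t)) ∂(Measure.pi fun _ => P)
        = ∫ ξ, ‖g ξ‖ ^ 2 ∂P := by
    intro t
    simp only [real_inner_self_eq_norm_sq]
    conv_rhs => rw [← (hmp t).map_eq]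
    rw [integral_map (hmp t).measurable.aemeasurable
      (hgm.norm.pow_const 2).aestronglyMeasurable]
  calc ∫ q : Fin M → Υ, ‖∑ t, g (q t)‖ ^ 2 ∂(Measure.pi fun _ => P)
      = ∫ q : Fin M → Υ, ∑ t, ∑ t', inner ℝ (g (q t)) (g (q t')) ∂(Measure.pi fun _ => P) := by
        simp only [← real_inner_self_eq_norm_sq, sum_inner, inner_sum]
        exact integral_congr_ae (Eventually.of_forall fun q => Finset.sum_comm)
    _ = ∑ t, ∑ t', ∫ q : Fin M → Υ, inner ℝ (g (q t)) (g (q t')) ∂(Measure.pi fun _ => P) := by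
        rw [integral_finsetSum _ fun t _ => integrable_finsetSum _ fun t' _ => hint t t']
        exact Finset.sum_congr rfl fun t _ => integral_finsetSum _ fun t' _ => hint t t'
    _ = ∑ t : Fin M, ∫ ξ, ‖g ξ‖ ^ 2 ∂P := by
        refine Finset.sum_congr rfl fun t _ => ?_
        rw [Finset.sum_eq_single t (fun t' _ h => hcross t t' h) (by simp), hdiag]
    _ = _ := by simp

end Batch

namespace AggregativeGame

variable {N n m : ℕ} {Ξ : Fin N → Type*} [∀ i, MeasurableSpace (Ξ i)]
  {𝒢 : AggregativeGame N n m Ξ}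

/-- The error of the batch approximation of the extended pseudogradient. -/
noncomputable def batchErr (𝒢 : AggregativeGame N n m Ξ) {M : ℕ} (q : Fin M → ∀ i, Ξ i) (i : Fin N)
    (x y : Vec n) : Vec n :=
  (1 / (M : ℝ)) • ∑ t, 𝒢.sampleGrad i x y (q t i) - 𝒢.extPseudograd i x y

theorem batchErr_eq {M : ℕ} (hM : 0 < M) (q : Fin M → ∀ i, Ξ i) (i : Fin N) (x y : Vec n) :
    𝒢.batchErr q i x y
      = (1 / (M : ℝ)) • ∑ t, (𝒢.sampleGrad i x y (q t i) - 𝒢.extPseudograd i x y) := by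
  have : (M : ℝ) ≠ 0 := by positivity
  rw [batchErr, Finset.sum_sub_distrib, smul_sub]
  simp [← Nat.cast_smul_eq_nsmul ℝ, smul_smul, this]

variable {σ : ℝ} {i : Fin N} {x y : Vec n} {M : ℕ}

theorem Assumptions.measurable_sampleGrad_sub (h : 𝒢.Assumptions) (i : Fin N) (x y : Vec n) :
    Measurable fun ξ : ∀ j, Ξ j => 𝒢.sampleGrad i x y (ξ i) - 𝒢.extPseudograd i x y :=
  (h.measurable_sampleGrad_comp i measurable_const measurable_const
    (measurable_pi_apply i)).sub_const _

theorem Assumptions.integral_sampleGrad_sub (h : 𝒢.Assumptions) (i : Fin N) (x y : Vec n) :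
    ∫ ξ, (𝒢.sampleGrad i x y (ξ i) - 𝒢.extPseudograd i x y) ∂𝒢.P = 0 := by
  have := h.isProbabilityMeasure
  rw [integral_sub (h.grad_integrable i x y) (integrable_const _), integral_const]
  simp [extPseudograd]

theorem Assumptions.memLp_batchErr (h : 𝒢.Assumptions) (hM : 0 < M)
    (hσ : ∫⁻ ξ, ‖𝒢.sampleGrad i x y (ξ i) - 𝒢.extPseudograd i x y‖ₑ ^ 2 ∂𝒢.P
      ≤ ENNReal.ofReal (σ ^ 2)) :
    MemLp (fun q : Fin M → ∀ j, Ξ j => 𝒢.batchErr q i x y) 2 (Measure.pi fun _ => 𝒢.P) := by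
  have := h.isProbabilityMeasure
  have hL := memLp_two_of_lintegral_le
    (h.measurable_sampleGrad_sub i x y).aestronglyMeasurable hσ
  simp only [batchErr_eq hM]
  exact (memLp_finsetSum _ fun t _ => memLp_eval_pi hL t).const_smul (1 / (M : ℝ))

theorem Assumptions.integral_batchErr (h : 𝒢.Assumptions) (hM : 0 < M)
    (hσ : ∫⁻ ξ, ‖𝒢.sampleGrad i x y (ξ i) - 𝒢.extPseudograd i x y‖ₑ ^ 2 ∂𝒢.P
      ≤ ENNReal.ofReal (σ ^ 2)) :
    ∫ q : Fin M → ∀ j, Ξ j, 𝒢.batchErr q i x y ∂(Measure.pi fun _ => 𝒢.P) = 0 := by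
  have := h.isProbabilityMeasure
  have hm := h.measurable_sampleGrad_sub i x y
  have hL := memLp_two_of_lintegral_le hm.aestronglyMeasurable hσ
  simp only [batchErr_eq hM]
  rw [integral_smul, integral_finsetSum _ fun t _ => (memLp_eval_pi hL t).integrable one_le_two,
    Finset.sum_eq_zero, smul_zero]
  intro t _
  have hmp := measurePreserving_eval (fun _ : Fin M => 𝒢.P) t
  rw [← h.integral_sampleGrad_sub i x y]
  conv_rhs => rw [← hmp.map_eq]
  rw [integral_map hmp.measurable.aemeasurable hm.aestronglyMeasurable]

theorem Assumptions.lintegral_batchErr_le (h : 𝒢.Assumptions) (hM : 0 < M)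
    (hσ : ∫⁻ ξ, ‖𝒢.sampleGrad i x y (ξ i) - 𝒢.extPseudograd i x y‖ₑ ^ 2 ∂𝒢.P
      ≤ ENNReal.ofReal (σ ^ 2)) :
    ∫⁻ q : Fin M → ∀ j, Ξ j, ‖𝒢.batchErr q i x y‖ₑ ^ 2 ∂(Measure.pi fun _ => 𝒢.P)
      ≤ ENNReal.ofReal (σ ^ 2 / M) := by
  have := h.isProbabilityMeasure
  have hm := h.measurable_sampleGrad_sub i x y
  have hL := memLp_two_of_lintegral_le hm.aestronglyMeasurable hσ
  rw [lintegral_enorm_sq_eq (h.memLp_batchErr hM hσ)]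
  refine ENNReal.ofReal_le_ofReal ?_
  rw [lintegral_enorm_sq_eq hL, ENNReal.ofReal_le_ofReal_iff (sq_nonneg σ)] at hσ
  have hM' : (0 : ℝ) < M := by positivity
  simp only [batchErr_eq hM, norm_smul, mul_pow, Real.norm_eq_abs, sq_abs]
  rw [integral_const_mul, integral_norm_sum_sq_pi hm hL (h.integral_sampleGrad_sub i x y)]
  rw [le_div_iff₀ hM']
  refine le_of_eq_of_le ?_ hσ
  field_simp

end AggregativeGame

/-! ### Almost sure convergence from noisy descent. -/

theorem BatchGrowth.summable {M : ℕ → ℕ} (h : BatchGrowth M) :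
    Summable fun k => (1 : ℝ) / (M k : ℝ) := by
  obtain ⟨-, c, k₀, a, hc, hk₀, ha, hM⟩ := h
  -- The growth bound starts at `k = 1`.
  rw [← summable_nat_add_iff 1]
  have h1 : Summable fun k : ℕ => c⁻¹ * (1 / (((k + 1 : ℕ) : ℝ) ^ (a + 1))) :=
    ((summable_nat_add_iff 1).2 (Real.summable_one_div_nat_rpow.2 (by linarith))).mul_left c⁻¹
  refine Summable.of_nonneg_of_le (fun k => by positivity) (fun k => ?_) h1
  have h2 := hM (k + 1) (by omega)
  have h3 : (((k + 1 : ℕ) : ℝ)) ^ (a + 1) ≤ (((k + 1 : ℕ) : ℝ) + k₀) ^ (a + 1) :=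
    Real.rpow_le_rpow (by positivity) (by linarith) (by linarith)
  have h4 : 0 < (((k + 1 : ℕ) : ℝ)) ^ (a + 1) := Real.rpow_pos_of_pos (by positivity) _
  rw [← one_div, one_div_mul_one_div]
  exact one_div_le_one_div_of_le (by positivity) ((mul_le_mul_of_nonneg_left h3 hc.le).trans h2)

/-- `V` need not be integrable, so the descent is integrated over `{V ≤ R}`. There `horth` kills the
cross terms, and `∑ ‖c k‖²` has integral at most `(R + ∑ v) / η`. Its terms therefore tend to zero
almost everywhere on each such set, and natural `R` suffice to cover the space. -/
theorem ae_tendsto_zero_of_noisy_descent {S E : Type*} [MeasurableSpace S] {μ : Measure S}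
    [IsProbabilityMeasure μ] [NormedAddCommGroup E] [InnerProductSpace ℝ E] {c e : ℕ → S → E}
    {V : S → ℝ} {v : ℕ → ℝ} {η : ℝ} (hη : 0 < η) (hc : ∀ k, MemLp (c k) 2 μ)
    (he : ∀ k, MemLp (e k) 2 μ) (hV : Measurable V) (hv : Summable v) (hv0 : ∀ k, 0 ≤ v k)
    (hev : ∀ k, ∫ ω, ‖e k ω‖ ^ 2 ∂μ ≤ v k)
    (horth : ∀ k (R : ℝ), ∫ ω in {ω | V ω ≤ R}, inner ℝ (e k ω) (c k ω) ∂μ = 0)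
    (hdesc : ∀ ω K, η * ∑ k ∈ Finset.range K, ‖c k ω‖ ^ 2
      ≤ V ω + ∑ k ∈ Finset.range K, (‖e k ω‖ ^ 2 - 2 * inner ℝ (e k ω) (c k ω))) :
    ∀ᵐ ω ∂μ, Tendsto (fun k => c k ω) atTop (𝓝 0) := by
  have hci := fun k => (memLp_two_iff_integrable_sq_norm (hc k).1).1 (hc k)
  have hei := fun k => (memLp_two_iff_integrable_sq_norm (he k).1).1 (he k)
  have hii := fun k => integrable_inner_of_memLp (he k) (hc k)
  have hdi : ∀ k, Integrable (fun ω => ‖e k ω‖ ^ 2 - 2 * inner ℝ (e k ω) (c k ω)) μ :=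
    fun k => (hei k).sub ((hii k).const_mul 2)
  have hB : ∀ R : ℝ, MeasurableSet {ω | V ω ≤ R} := fun R => hV measurableSet_Iic
  have key : ∀ R : ℕ, ∀ᵐ ω ∂(μ.restrict {ω | V ω ≤ R}), Tendsto (fun k => c k ω) atTop (𝓝 0) := by
    intro R
    set B := {ω | V ω ≤ (R : ℝ)} with hBdef
    have hbound : ∀ K, ∑ k ∈ Finset.range K, ∫ ω in B, ‖c k ω‖ ^ 2 ∂μ ≤ (R + ∑' k, v k) / η := by
      intro K
      rw [le_div_iff₀' hη]
      have h1 : ∫ ω in B, η * ∑ k ∈ Finset.range K, ‖c k ω‖ ^ 2 ∂μ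
          ≤ ∫ ω in B, ((R : ℝ) + ∑ k ∈ Finset.range K,
            (‖e k ω‖ ^ 2 - 2 * inner ℝ (e k ω) (c k ω))) ∂μ := by
        refine setIntegral_mono_on ?_ ?_ (hB R) fun ω hω => ?_
        · exact ((integrable_finsetSum _ fun k _ => hci k).const_mul η).integrableOn
        · exact ((integrable_const _).add (integrable_finsetSum _ fun k _ => hdi k)).integrableOn
        · exact (hdesc ω K).trans (by gcongr; exact hω)
      rw [integral_const_mul, integral_finsetSum _ fun k _ => (hci k).integrableOn,
        integral_add (integrable_const _) (integrable_finsetSum _ fun k _ =>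
          (hdi k).integrableOn),
        integral_finsetSum _ fun k _ => (hdi k).integrableOn] at h1
      refine h1.trans (add_le_add ?_ ?_)
      · rw [integral_const, smul_eq_mul, measureReal_restrict_apply_univ]
        exact mul_le_of_le_one_left (Nat.cast_nonneg R) measureReal_le_one
      · refine le_trans (Finset.sum_le_sum fun k _ => ?_) (hv.sum_le_tsum _ fun k _ => hv0 k)
        rw [integral_sub (hei k).integrableOn ((hii k).const_mul 2).integrableOn,
          integral_const_mul, horth, mul_zero, sub_zero]
        exact (setIntegral_le_integral (hei k) (Eventually.of_forall fun ω => sq_nonneg _)).trans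
          (hev k)
    have hfin : ∫⁻ ω in B, ∑' k, ‖c k ω‖ₑ ^ 2 ∂μ ≠ ⊤ := by
      rw [lintegral_tsum fun k => ((hc k).1.restrict.enorm.pow_const 2)]
      refine ne_top_of_le_ne_top (ENNReal.ofReal_ne_top (r := (R + ∑' k, v k) / η))
        (ENNReal.tsum_le_of_sum_range_le fun K => ?_)
      rw [Finset.sum_congr rfl fun k _ => lintegral_enorm_sq_eq ((hc k).restrict B),
        ← ENNReal.ofReal_sum_of_nonneg fun k _ => integral_nonneg fun ω => sq_nonneg _]
      exact ENNReal.ofReal_le_ofReal (hbound K)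
    have hae := ae_lt_top' (AEMeasurable.tsum fun k =>
      ((hc k).1.restrict.enorm.pow_const 2)) hfin
    filter_upwards [hae] with ω hω
    have h1 := ENNReal.tendsto_atTop_zero_of_tsum_ne_top hω.ne
    rw [tendsto_zero_iff_norm_tendsto_zero]
    have h2 := (ENNReal.tendsto_toReal ENNReal.zero_ne_top).comp h1
    have h3 : Tendsto (fun k => ‖c k ω‖ ^ 2) atTop (𝓝 0) := by
      refine h2.congr fun k => ?_
      simp [toReal_enorm]
    have h4 := h3.sqrt
    simpa [Real.sqrt_sq] using h4
  have hall := ae_all_iff.2 fun R : ℕ => (ae_restrict_iff' (hB R)).1 (key R)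
  filter_upwards [hall] with ω hω
  obtain ⟨R, hR⟩ := exists_nat_ge (V ω)
  exact hω R hR

/-! ### Gradient errors along a run. -/

section Convergence

variable {N n m : ℕ} {Ξ : Fin N → Type*} [∀ i, MeasurableSpace (Ξ i)]
  {𝒢 : AggregativeGame N n m Ξ} {G : SimpleGraph (Fin N)} [DecidableRel G.Adj]
  {w : Fin N → Fin N → ℝ} {S : Type*} {M : ℕ → ℕ}
  {ζ : (k : ℕ) → Fin (M k) → S → (∀ i, Ξ i)} {x s : ℕ → S → Fin N → Vec n}
  {z lam : ℕ → S → Fin N → Vec m}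

theorem IsNodeRun.isNodePath {α ν δ : Fin N → ℝ} {γ : ℝ}
    (h : IsNodeRun 𝒢 G w α (fun _ => γ) ν δ M ζ x s z lam) (ω : S) :
    IsNodePath 𝒢 G w α γ ν δ
      (fun k => WithLp.toLp 2 fun i => (1 / (M k : ℝ)) •
        ∑ t, 𝒢.sampleGrad i (x k ω i) (x k ω i + s k ω i) (ζ k t ω i))
      (fun k => WithLp.toLp 2 (x k ω)) (fun k => WithLp.toLp 2 (s k ω))
      (fun k => WithLp.toLp 2 (z k ω)) (fun k => WithLp.toLp 2 (lam k ω)) where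
  init_x := h.init_x ω
  init_s := by
    ext i : 1
    exact h.init_s ω i
  init_lam := h.init_lam ω
  step_x k i := h.step_x k ω i
  step_s k := by
    ext i : 1
    exact h.step_s k ω i
  step_z k i := h.step_z k ω i
  step_lam k i := h.step_lam k ω i

variable {α γ ν δ : Fin N → ℝ} [MeasurableSpace S] {μ : Measure S} [IsProbabilityMeasure μ]

/-- The state and the initial point are independent of the samples of the current iteration. -/
theorem IsNodeRun.indepFun_batch (h𝒢 : 𝒢.Assumptions) (hα : ∀ i, 0 < α i)
    (h : IsNodeRun 𝒢 G w α γ ν δ M ζ x s z lam) (hζ : ∀ k t, Measurable (ζ k t))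
    (hind : iIndepFun (fun (p : Σ k, Fin (M k)) => ζ p.1 p.2) μ)
    (hx : Measurable (x 0)) (hz : Measurable (z 0)) (hlam : Measurable (lam 0))
    (hinit : IndepFun (fun ω => (x 0 ω, z 0 ω, lam 0 ω))
      (fun ω (p : Σ k, Fin (M k)) => ζ p.1 p.2 ω) μ) (k : ℕ) :
    IndepFun (fun ω => (x k ω, s k ω, (x 0 ω, z 0 ω, lam 0 ω))) (fun ω t => ζ k t ω) μ := by
  have hp := indepFun_past (hx.prodMk (hz.prodMk hlam)) hζ hind hinit k
  set past := fun ω => ((x 0 ω, z 0 ω, lam 0 ω), fun p : pastIndices M k => ζ p.1.1 p.1.2 ω)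
    with hpast
  have hcm : Measurable[MeasurableSpace.comap past inferInstance] past := comap_measurable past
  have h0 : Measurable[MeasurableSpace.comap past inferInstance]
      fun ω => (x 0 ω, z 0 ω, lam 0 ω) := measurable_fst.comp hcm
  have hζ' : ∀ j < k, ∀ t, Measurable[MeasurableSpace.comap past inferInstance] (ζ j t) := by
    intro j hj t
    have hmem : (⟨j, t⟩ : Σ k, Fin (M k)) ∈ pastIndices M k := by simp [pastIndices, hj]
    exact (measurable_pi_apply (⟨⟨j, t⟩, hmem⟩ : pastIndices M k)).comp (measurable_snd.comp hcm)
  -- Measurability for the σ-algebra generated by the initial point and the past samples says that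
  -- the state is a function of them, so it inherits their independence of the batch.
  obtain ⟨h1, h2, -, -⟩ := @IsNodeRun.measurable N n m Ξ _ 𝒢 G _ w α γ ν δ S M ζ x s z lam
    (MeasurableSpace.comap past inferInstance) h𝒢 hα h (measurable_fst.comp h0)
    (measurable_fst.comp (measurable_snd.comp h0)) (measurable_snd.comp (measurable_snd.comp h0))
    k hζ'
  rw [IndepFun_iff_Indep] at hp ⊢
  exact indep_of_indep_of_le_left hp (h1.prodMk (h2.prodMk h0)).comap_le

/-- The error of the gradient estimates of all agents at iteration `k`. -/
noncomputable def gradError (𝒢 : AggregativeGame N n m Ξ) (ζ : (k : ℕ) → Fin (M k) → S → (∀ i, Ξ i))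
    (x s : ℕ → S → Fin N → Vec n) (k : ℕ) (ω : S) : Prof N n :=
  WithLp.toLp 2 fun i => 𝒢.batchErr (fun t => ζ k t ω) i (x k ω i) (x k ω i + s k ω i)

theorem AggregativeGame.Assumptions.measurable_batchErr (h𝒢 : 𝒢.Assumptions) (K : ℕ) (i : Fin N) :
    Measurable fun p : (Vec n × Vec n) × (Fin K → ∀ j, Ξ j) =>
      𝒢.batchErr p.2 i p.1.1 p.1.2 := by
  have h1 : ∀ t, Measurable fun p : (Vec n × Vec n) × (Fin K → ∀ j, Ξ j) =>
      𝒢.sampleGrad i p.1.1 p.1.2 (p.2 t i) := fun t =>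
    h𝒢.measurable_sampleGrad_comp i (by fun_prop) (by fun_prop) (by fun_prop)
  have h2 : Measurable fun p : (Vec n × Vec n) × (Fin K → ∀ j, Ξ j) =>
      𝒢.extPseudograd i p.1.1 p.1.2 := (h𝒢.measurable_extPseudograd i).comp measurable_fst
  unfold AggregativeGame.batchErr
  fun_prop

theorem AggregativeGame.Assumptions.measurable_batchErr_comp (h𝒢 : 𝒢.Assumptions) {K : ℕ}
    (i : Fin N) {a b : S → Vec n} {q : S → Fin K → ∀ j, Ξ j} (ha : Measurable a)
    (hb : Measurable b) (hq : Measurable q) :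
    Measurable fun ω => 𝒢.batchErr (q ω) i (a ω) (b ω) := by
  have e : Measurable fun ω => ((a ω, b ω), q ω) := (ha.prodMk hb).prodMk hq
  exact Measurable.comp (g := fun p : (Vec n × Vec n) × (Fin K → ∀ j, Ξ j) =>
    𝒢.batchErr p.2 i p.1.1 p.1.2) (f := fun ω => ((a ω, b ω), q ω)) (h𝒢.measurable_batchErr K i) e

theorem prof_norm_sq_eq {N k : ℕ} (x : Prof N k) : ‖x‖ ^ 2 = ∑ i, ‖x i‖ ^ 2 :=
  PiLp.norm_sq_eq_of_L2 _ x

variable {R σ : ℝ}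

theorem measurable_gradError (h𝒢 : 𝒢.Assumptions) {k : ℕ} (hx : Measurable (x k))
    (hs : Measurable (s k)) (hζ : ∀ t, Measurable (ζ k t)) :
    Measurable (gradError 𝒢 ζ x s k) := by
  refine (WithLp.measurable_toLp 2 _).comp (measurable_pi_lambda _ fun i => ?_)
  have hxi : Measurable fun ω => x k ω i := (measurable_pi_apply i).comp hx
  have hsi : Measurable fun ω => s k ω i := (measurable_pi_apply i).comp hs
  exact h𝒢.measurable_batchErr_comp i hxi (hxi.add hsi) (measurable_pi_lambda _ hζ)

/-- By independence the batch is integrated first with the state frozen; the fixed-point variance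
bound applies uniformly because decisions stay in `Ω i` and estimates in the ball of radius `R`. -/
theorem gradError_component_bound (h𝒢 : 𝒢.Assumptions) {k : ℕ} (hM : 0 < M k)
    (hσ : ∀ i, ∀ a ∈ 𝒢.Ω i, ∀ y : Vec n, ‖y‖ ≤ R →
      ∫⁻ ξ, ‖𝒢.sampleGrad i a y (ξ i) - 𝒢.extPseudograd i a y‖ₑ ^ 2 ∂𝒢.P ≤ ENNReal.ofReal (σ ^ 2))
    (hxΩ : ∀ ω i, x k ω i ∈ 𝒢.Ω i) (hu : ∀ ω i, ‖x k ω i + s k ω i‖ ≤ R)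
    (hx : Measurable (x k)) (hs : Measurable (s k)) (hζ : ∀ t, Measurable (ζ k t))
    (hlaw : μ.map (fun ω t => ζ k t ω) = Measure.pi fun _ : Fin (M k) => 𝒢.P)
    (hind : IndepFun (fun ω => (x k ω, s k ω, (x 0 ω, z 0 ω, lam 0 ω))) (fun ω t => ζ k t ω) μ)
    (i : Fin N) :
    MemLp (fun ω => gradError 𝒢 ζ x s k ω i) 2 μ ∧
      ∫ ω, ‖gradError 𝒢 ζ x s k ω i‖ ^ 2 ∂μ ≤ σ ^ 2 / M k := by
  have hE := measurable_gradError h𝒢 hx hs hζ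
  have hEi : Measurable fun ω => gradError 𝒢 ζ x s k ω i :=
    (measurable_pi_apply i).comp ((WithLp.measurable_ofLp 2 _).comp hE)
  have hsel : Measurable fun p : (Fin N → Vec n) × (Fin N → Vec n) ×
      ((Fin N → Vec n) × (Fin N → Vec m) × (Fin N → Vec m)) => (p.1 i, p.1 i + p.2.1 i) := by
    fun_prop
  have hindY : IndepFun (fun ω => (x k ω i, x k ω i + s k ω i)) (fun ω t => ζ k t ω) μ :=
    hind.comp hsel measurable_id
  have hxi : Measurable fun ω => x k ω i := (measurable_pi_apply i).comp hx
  have hsi : Measurable fun ω => s k ω i := (measurable_pi_apply i).comp hs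
  have hle : ∫⁻ ω, ‖gradError 𝒢 ζ x s k ω i‖ₑ ^ 2 ∂μ ≤ ENNReal.ofReal (σ ^ 2 / M k) := by
    have e := hindY.lintegral_comp (hxi.prodMk (hxi.add hsi)) (measurable_pi_lambda _ hζ)
      (φ := fun p => ‖𝒢.batchErr p.2 i p.1.1 p.1.2‖ₑ ^ 2)
      ((h𝒢.measurable_batchErr (M k) i).enorm.pow_const 2)
    rw [hlaw] at e
    refine (le_of_eq e).trans ?_
    calc _ ≤ ∫⁻ _, ENNReal.ofReal (σ ^ 2 / M k) ∂μ := lintegral_mono fun ω =>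
          h𝒢.lintegral_batchErr_le hM (hσ i _ (hxΩ ω i) _ (hu ω i))
      _ = _ := by simp
  have hL := memLp_two_of_lintegral_le hEi.aestronglyMeasurable hle
  refine ⟨hL, ?_⟩
  rw [lintegral_enorm_sq_eq hL] at hle
  exact (ENNReal.ofReal_le_ofReal_iff (by positivity)).1 hle

theorem setIntegral_inner_gradError (h𝒢 : 𝒢.Assumptions) {k : ℕ} (hM : 0 < M k)
    (hσ : ∀ i, ∀ a ∈ 𝒢.Ω i, ∀ y : Vec n, ‖y‖ ≤ R →
      ∫⁻ ξ, ‖𝒢.sampleGrad i a y (ξ i) - 𝒢.extPseudograd i a y‖ₑ ^ 2 ∂𝒢.P ≤ ENNReal.ofReal (σ ^ 2))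
    (hxΩ : ∀ ω i, x k ω i ∈ 𝒢.Ω i) (hu : ∀ ω i, ‖x k ω i + s k ω i‖ ≤ R)
    (hx : Measurable (x k)) (hs : Measurable (s k)) (hζ : ∀ t, Measurable (ζ k t))
    (hx0 : Measurable (x 0)) (hz0 : Measurable (z 0)) (hlam0 : Measurable (lam 0))
    (hlaw : μ.map (fun ω t => ζ k t ω) = Measure.pi fun _ : Fin (M k) => 𝒢.P)
    (hind : IndepFun (fun ω => (x k ω, s k ω, (x 0 ω, z 0 ω, lam 0 ω))) (fun ω t => ζ k t ω) μ)
    {B : Set ((Fin N → Vec n) × (Fin N → Vec m) × (Fin N → Vec m))} (hB : MeasurableSet B)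
    (xs : Fin N → Vec n) {i : Fin N}
    (hint : Integrable (fun ω => inner ℝ (gradError 𝒢 ζ x s k ω i) (x k ω i - xs i)) μ) :
    ∫ ω in (fun ω => (x 0 ω, z 0 ω, lam 0 ω)) ⁻¹' B,
      inner ℝ (gradError 𝒢 ζ x s k ω i) (x k ω i - xs i) ∂μ = 0 := by
  have hBm : MeasurableSet ((fun ω => (x 0 ω, z 0 ω, lam 0 ω)) ⁻¹' B) :=
    (hx0.prodMk (hz0.prodMk hlam0)) hB
  -- The indicator of the initial event is moved into the vector paired with the error. It belongs
  -- to the frozen state, so integrating the batch first gives zero.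
  let Φ : (Fin N → Vec n) × (Fin N → Vec n) ×
      ((Fin N → Vec n) × (Fin N → Vec m) × (Fin N → Vec m)) → (Vec n × Vec n) × Vec n :=
    fun p => ((p.1 i, p.1 i + p.2.1 i),
      Set.indicator ((fun p => p.2.2) ⁻¹' B) (fun p => p.1 i - xs i) p)
  have hΦ : Measurable Φ := by
    refine Measurable.prodMk (by fun_prop) (Measurable.indicator (by fun_prop) ?_)
    exact (measurable_snd.comp measurable_snd) hB
  set st := fun ω => (x k ω, s k ω, (x 0 ω, z 0 ω, lam 0 ω)) with hst
  have hstm : Measurable st := hx.prodMk (hs.prodMk (hx0.prodMk (hz0.prodMk hlam0)))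
  have hindY : IndepFun (fun ω => Φ (st ω)) (fun ω t => ζ k t ω) μ :=
    hind.comp hΦ measurable_id
  have hφ : Measurable fun p : ((Vec n × Vec n) × Vec n) × (Fin (M k) → ∀ j, Ξ j) =>
      inner ℝ (𝒢.batchErr p.2 i p.1.1.1 p.1.1.2) p.1.2 := by
    exact (h𝒢.measurable_batchErr_comp i (by fun_prop) (by fun_prop) (by fun_prop)).inner
      (by fun_prop)
  have heq : (fun ω => inner ℝ (𝒢.batchErr (fun t => ζ k t ω) i (Φ (st ω)).1.1 (Φ (st ω)).1.2)
      (Φ (st ω)).2) = Set.indicator ((fun ω => (x 0 ω, z 0 ω, lam 0 ω)) ⁻¹' B)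
        (fun ω => inner ℝ (gradError 𝒢 ζ x s k ω i) (x k ω i - xs i)) := by
    funext ω
    by_cases hω : (x 0 ω, z 0 ω, lam 0 ω) ∈ B
    · simp [Φ, hst, Set.indicator, hω, gradError]
    · simp [Φ, hst, Set.indicator, hω]
  have e := hindY.integral_comp (hΦ.comp hstm) (measurable_pi_lambda _ hζ) hφ
    (by have h1 := hint.indicator hBm; rwa [← heq] at h1)
  rw [← integral_indicator hBm, ← heq]
  refine e.trans ?_
  rw [hlaw]
  refine integral_eq_zero_of_ae (Eventually.of_forall fun ω => ?_)
  have hvar := hσ i _ (hxΩ ω i) _ (hu ω i)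
  have hL := h𝒢.memLp_batchErr hM hvar
  have := h𝒢.isProbabilityMeasure
  have h3 := integral_inner (𝕜 := ℝ) (hL.integrable one_le_two) (Φ (st ω)).2
  rw [h𝒢.integral_batchErr hM hvar, inner_zero_right] at h3
  simp only [Pi.zero_apply]
  rw [← h3]
  exact integral_congr_ae (Eventually.of_forall fun q => real_inner_comm _ _)

end Convergence

/-! ### Assembly of the argument. -/

theorem theorem3 {N n m : ℕ} {Ξ : Fin N → Type*} [∀ i, MeasurableSpace (Ξ i)]
    (𝒢 : AggregativeGame N n m Ξ) (h𝒢 : 𝒢.Assumptions)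
    (G : SimpleGraph (Fin N)) [DecidableRel G.Adj] (hG : G.Connected)
    (w : Fin N → Fin N → ℝ) (hw_symm : ∀ i j, w i j = w j i)
    (hw_pos : ∀ i j, G.Adj i j → 0 < w i j) :
    ∃ xstar : Fin N → Vec n, 𝒢.IsVSGNE xstar ∧ (∀ y, 𝒢.IsVSGNE y → y = xstar) ∧
      ∃ αbar νbar δbar : ℝ, 0 < αbar ∧ 0 < νbar ∧ 0 < δbar ∧
      ∃ γ : Fin N → ℝ, (∀ i, 0 < γ i) ∧
      ∀ α ν δ : Fin N → ℝ, (∀ i, α i ∈ Set.Ioo 0 αbar) → (∀ i, ν i ∈ Set.Ioo 0 νbar) →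
        (∀ i, δ i ∈ Set.Ioo 0 δbar) →
      ∀ (S : Type*) [MeasurableSpace S] (μ : Measure S) [IsProbabilityMeasure μ]
        (M : ℕ → ℕ) (ζ : (k : ℕ) → Fin (M k) → S → (∀ i, Ξ i))
        (x s : ℕ → S → Fin N → Vec n) (z lam : ℕ → S → Fin N → Vec m),
        BatchGrowth M →
        (∀ k t, Measurable (ζ k t)) →
        (∀ k t, μ.map (ζ k t) = 𝒢.P) →
        iIndepFun (fun (p : Σ k, Fin (M k)) => ζ p.1 p.2) μ →
        Measurable (x 0) → Measurable (z 0) → Measurable (lam 0) →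
        IndepFun (fun ω => (x 0 ω, z 0 ω, lam 0 ω))
          (fun ω (p : Σ k, Fin (M k)) => ζ p.1 p.2 ω) μ →
        IsNodeRun 𝒢 G w α γ ν δ M ζ x s z lam →
        ∀ᵐ ω ∂μ, Tendsto (fun k => x k ω) atTop (𝓝 xstar) := by
  obtain ⟨xs, ls, hk⟩ := h𝒢.exists_isKKT
  refine ⟨xs, ⟨h𝒢.isSGNE_of_solvesSVI hk.solvesSVI, hk.solvesSVI⟩,
    fun y hy => h𝒢.solvesSVI_unique hk.solvesSVI hy.2, ?_⟩
  obtain ⟨αbar, νbar, δbar, γ, R, η, hαb, hνb, hδb, hγ, hη, hmain⟩ :=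
    h𝒢.exists_stepsizes hG hw_symm hw_pos hk
  refine ⟨αbar, νbar, δbar, hαb, hνb, hδb, fun _ => γ, fun _ => hγ, ?_⟩
  intro α ν δ hα hν hδ S _ μ _ M ζ x s z lam hM hζ hlaw hind hx0 hz0 hlam0 hinit hrun
  obtain ⟨V, hVc, hV⟩ := hmain α ν δ hα hν hδ
  -- The radius is known before the run is considered, so a single `σ` serves all iterations.
  obtain ⟨σ, -, hσ⟩ := h𝒢.variance R
  obtain ⟨B, hB⟩ := h𝒢.isCompact_profDomain.isBounded.exists_norm_le
  have hmeas := fun k => hrun.measurable h𝒢 (fun i => (hα i).1) hx0 hz0 hlam0 k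
    fun j _ t => hζ j t
  have hindk := hrun.indepFun_batch h𝒢 (fun i => (hα i).1) hζ hind hx0 hz0 hlam0 hinit
  have hlawk := map_batch_eq_pi hζ hlaw hind
  have hu : ∀ k ω i, ‖x k ω i + s k ω i‖ ≤ R := fun k ω i =>
    (hV _ _ _ _ _ (hrun.isNodePath ω)).1 k i
  have hdom : ∀ k ω, (WithLp.toLp 2 (x k ω) : Prof N n) ∈ 𝒢.profDomain := fun k ω =>
    (hrun.isNodePath ω).mem_domain k
  set X : Prof N n := WithLp.toLp 2 xs with hX
  have hcomp := fun k i => gradError_component_bound h𝒢 (hM.1 k) hσ (fun ω i => hdom k ω i) (hu k)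
    (hmeas k).1 (hmeas k).2.1 (hζ k) (hlawk k) (hindk k) i
  have hcompI := fun k i => (memLp_two_iff_integrable_sq_norm (hcomp k i).1.1).1 (hcomp k i).1
  have hc : ∀ k, MemLp (fun ω => (WithLp.toLp 2 (x k ω) : Prof N n) - X) 2 μ := fun k =>
    MemLp.of_bound (((WithLp.measurable_toLp 2 _).comp (hmeas k).1).sub_const X).aestronglyMeasurable
      (B + ‖X‖) (Eventually.of_forall fun ω => (norm_sub_le _ _).trans
        (add_le_add_left (hB _ (hdom k ω)) _))
  have hci : ∀ k i, MemLp (fun ω => x k ω i - xs i) 2 μ := fun k i =>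
    MemLp.of_bound (((measurable_pi_apply i).comp (hmeas k).1).sub_const (xs i)).aestronglyMeasurable
      (B + ‖X‖) (Eventually.of_forall fun ω =>
        (PiLp.norm_apply_le ((WithLp.toLp 2 (x k ω) : Prof N n) - X) i).trans
          ((norm_sub_le _ _).trans (add_le_add_left (hB _ (hdom k ω)) _)))
  have he : ∀ k, MemLp (gradError 𝒢 ζ x s k) 2 μ := fun k => by
    refine (memLp_two_iff_integrable_sq_norm
      (measurable_gradError h𝒢 (hmeas k).1 (hmeas k).2.1 (hζ k)).aestronglyMeasurable).2 ?_
    simp only [prof_norm_sq_eq]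
    exact integrable_finsetSum _ fun i _ => hcompI k i
  have hev : ∀ k, ∫ ω, ‖gradError 𝒢 ζ x s k ω‖ ^ 2 ∂μ ≤ N * σ ^ 2 * (1 / M k) := fun k => by
    simp only [prof_norm_sq_eq]
    rw [integral_finsetSum _ fun i _ => hcompI k i]
    refine (Finset.sum_le_sum fun i _ => (hcomp k i).2).trans_eq ?_
    simp
    ring
  have hVc' : Continuous fun p : (Fin N → Vec n) × (Fin N → Vec m) × (Fin N → Vec m) =>
      V (WithLp.toLp 2 p.1) (WithLp.toLp 2 p.2.1) (WithLp.toLp 2 p.2.2) := by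
    have h1 : Continuous fun p : (Fin N → Vec n) × (Fin N → Vec m) × (Fin N → Vec m) =>
        ((WithLp.toLp 2 p.1, WithLp.toLp 2 p.2.1, WithLp.toLp 2 p.2.2) :
          Prof N n × Prof N m × Prof N m) := by fun_prop
    exact hVc.comp h1
  have hconv := ae_tendsto_zero_of_noisy_descent hη hc he
    (V := fun ω => V (WithLp.toLp 2 (x 0 ω)) (WithLp.toLp 2 (z 0 ω)) (WithLp.toLp 2 (lam 0 ω)))
    (hVc'.measurable.comp (hx0.prodMk (hz0.prodMk hlam0)))
    (hM.summable.mul_left (N * σ ^ 2)) (fun k => by positivity) hev ?_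
    (fun ω K => (hV _ _ _ _ _ (hrun.isNodePath ω)).2 K)
  · filter_upwards [hconv] with ω hω
    rw [tendsto_pi_nhds]
    intro i
    rw [tendsto_iff_norm_sub_tendsto_zero]
    exact squeeze_zero (fun k => norm_nonneg _)
      (fun k => PiLp.norm_apply_le ((WithLp.toLp 2 (x k ω) : Prof N n) - X) i)
      (tendsto_zero_iff_norm_tendsto_zero.1 hω)
  -- Orthogonality is checked agent by agent; the sublevel set of `V` is an event of the initial
  -- point since `V` is continuous.
  · intro k r
    simp only [prof_inner_eq]
    have hI : ∀ i, Integrable (fun ω => inner ℝ (gradError 𝒢 ζ x s k ω i)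
        (((WithLp.toLp 2 (x k ω) : Prof N n) - X) i)) μ := fun i =>
      integrable_inner_of_memLp (hcomp k i).1 (hci k i)
    rw [integral_finsetSum _ fun i _ => (hI i).integrableOn]
    refine Finset.sum_eq_zero fun i _ => ?_
    exact setIntegral_inner_gradError h𝒢 (hM.1 k) hσ (fun ω i => hdom k ω i) (hu k) (hmeas k).1
      (hmeas k).2.1 (hζ k) hx0 hz0 hlam0 (hlawk k) (hindk k) (hVc'.measurable measurableSet_Iic)
      xs (hI i)
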